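/- Let $G_A$ be a real (smooth) Banach-Lie group with Lie algebra $\mathfrak g_A=T_{\mathbf 1}G_A$, and let $G_B\subseteq G_A$ be a Banach-Lie subgroup (a subgroup that is a split submanifold) with Lie algebra $\mathfrak g_B$. Let $\rho_A\colon G_A\to\mathcal B(\mathcal H_A)$ be a norm-continuous unitary representation on a complex Hilbert space, let $\mathcal H_B\subseteq\mathcal H_A$ be a closed subspace with $\rho_A(w)\mathcal H_B\subseteq\mathcal H_B$ for all $w\in G_B$, let $P\colon\mathcal H_A\to\mathcal H_B$ be the orthogonal projection, and let $d\rho_A\colon\mathfrak g_A\to\mathcal B(\mathcal H_A)$ be the derivative of $\rho_A$ at $\mathbf 1$. For $u\in G_A$ and $X\in\mathfrak g_A$ write $uX\in T_uG_A$ for the left translate of $X$. Let $D=G_A\times_{G_B}\mathcal H_B$ be the homogeneous vector bundle over $G_A/G_B$, that is, the quotient of $G_A\times\mathcal H_B$ by $(u,f)\sim(uw,\rho_A(w)^{-1}f)$, $w\in G_B$, with its canonical Banach manifold structure. For $g\in G_A$, $X\in\mathfrak g_A$, $f,h\in\mathcal H_B$ let $[((g,X),(f,h))]\in TD$ be the image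 of the tangent vector $(gX,h)\in T_{(g,f)}(G_A\times\mathcal H_B)$ under the tangent map of the quotient map. Let $\Phi_\rho\colon TD\to TD$ be the natural connection $$\Phi_\rho\colon[((g,X),(f,h))]\mapsto[((g,0),(f,P(d\rho_A(X)f)+h))].$$ The covariant derivative of a smooth section $\sigma$ is $\nabla\sigma=r\circ\Phi_\rho\circ T\sigma$, where $r$ sends the vertical vector $\frac{d}{dt}\big|_{t=0}(x+ty)$ (with $x,y$ in the same fibre of $D$) to $y$. Let $\mathfrak m$ be any closed linear subspace of $\mathfrak g_A$ with $\mathfrak g_A=\mathfrak g_B\dotplus\mathfrak m$, and for $u\in G_A$, $X\in\mathfrak m$ let $[(u,X)]\in T(G_A/G_B)$ be the image of $uX$ under the tangent map of $G_A\to G_A/G_B$. Let $\phi\colon G_A\to\mathcal H_B$ be smooth with $\phi(uw)=\rho_A(w)^{-1}\phi(u)$ for all $u\in G_A$, $w\in G_B$, and put $\sigma(uG_B)=[(u,\phi(u))]$. Then $\Phi_\rho$ is well defined by the above formula, $\sigma$ is a smooth section of $D$, every tangent vector of $G_A/G_B$ is of the form $[(u,X)]$ with $u\in G_A$, $X\in\mathfrak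 m$, and for all $u\in G_A$ and $X\in\mathfrak m$ $$(\nabla\sigma)([(u,X)])=[(u,\,d\phi(u,X)+P(d\rho_A(X)\phi(u)))],$$ where $d\phi(u,X)$ is the derivative of $\phi$ at $u$ in the direction $uX$. -/

import Mathlib

open scoped Manifold ContDiff
open Set Function

/-- A (split) Banach-Lie subgroup of a Banach-Lie group `G` modelled on the Banach space `E`:
a subgroup that is a split submanifold, i.e. around each of its points there is a smooth chart
of `G` that maps the subgroup onto the trace of a closed complemented subspace of `E`. -/
structure BanachLieSubgroup (E G : Type*) [NormedAddCommGroup E] [NormedSpace ℝ E]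
    [TopologicalSpace G] [ChartedSpace E G] [Group G] extends Subgroup G where
  exists_slice : ∀ h ∈ toSubgroup, ∃ (F : Submodule ℝ E) (c : OpenPartialHomeomorph G E),
    F.ClosedComplemented ∧ c ∈ IsManifold.maximalAtlas 𝓘(ℝ, E) ∞ G ∧ h ∈ c.source ∧
      ∀ x ∈ c.source, (x ∈ toSubgroup ↔ c x ∈ F)

namespace BanachLieSubgroup

variable {E G : Type*} [NormedAddCommGroup E] [NormedSpace ℝ E]
  [TopologicalSpace G] [ChartedSpace E G] [Group G]

section Model

variable (H : BanachLieSubgroup E G)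

/-- The subspace of `E` on which the subgroup is modelled near `1`. -/
noncomputable def sliceSpace : Submodule ℝ E := (H.exists_slice 1 H.one_mem).choose

/-- A slice chart of the subgroup at `1`. -/
noncomputable def sliceChart : OpenPartialHomeomorph G E :=
  (H.exists_slice 1 H.one_mem).choose_spec.choose

theorem slice_spec : H.sliceSpace.ClosedComplemented ∧
    H.sliceChart ∈ IsManifold.maximalAtlas 𝓘(ℝ, E) ∞ G ∧ 1 ∈ H.sliceChart.source ∧
      ∀ x ∈ H.sliceChart.source, (x ∈ H.toSubgroup ↔ H.sliceChart x ∈ H.sliceSpace) :=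
  (H.exists_slice 1 H.one_mem).choose_spec.choose_spec

/-- A continuous projection of `E` onto the model space of the subgroup. -/
noncomputable def sliceProj : E →L[ℝ] H.sliceSpace := H.slice_spec.1.choose

theorem sliceProj_apply (x : H.sliceSpace) : H.sliceProj x = x := H.slice_spec.1.choose_spec x

/-- The model space of the quotient `G ⧸ H`: a closed complement in `E` of the model space of the
subgroup. -/
noncomputable def Model : Submodule ℝ E := H.sliceProj.ker

/-- The projection of `E` onto `H.Model` along the model space of the subgroup. -/
noncomputable def modelProj : E →L[ℝ] H.Model :=
  (ContinuousLinearMap.id ℝ E - H.sliceSpace.subtypeL.comp H.sliceProj).codRestrict H.Model (by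
    intro x
    have := H.sliceProj_apply (H.sliceProj x)
    simp [Model, this])

theorem coe_modelProj (x : E) : (H.modelProj x : E) = x - H.sliceProj x := rfl

theorem modelProj_coe (x : H.Model) : H.modelProj x = x := by
  have : H.sliceProj x = 0 := x.2
  ext
  simp [coe_modelProj, this]

theorem modelProj_slice (x : H.sliceSpace) : H.modelProj x = 0 := by
  ext
  simp [coe_modelProj, H.sliceProj_apply]

/-- The inverse of the slice chart, recentred at `0`. -/
noncomputable def slicePar (x : E) : G := H.sliceChart.symm (H.sliceChart 1 + x)

theorem slicePar_zero : H.slicePar 0 = 1 := by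
  simp [slicePar, H.sliceChart.left_inv H.slice_spec.2.2.1]

theorem sliceChart_one_mem : H.sliceChart 1 ∈ H.sliceSpace :=
  (H.slice_spec.2.2.2 1 H.slice_spec.2.2.1).1 H.one_mem

variable [LieGroup 𝓘(ℝ, E) ∞ G] [CompleteSpace E]

/-- Near `1`, the group is smoothly the product of the transversal slice and the subgroup. -/
theorem exists_tube : ∃ T : OpenPartialHomeomorph E G, 0 ∈ T.source ∧
    ContMDiffOn 𝓘(ℝ, E) 𝓘(ℝ, E) ∞ T T.source ∧ ContMDiffOn 𝓘(ℝ, E) 𝓘(ℝ, E) ∞ T.symm T.target ∧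
    (∀ v ∈ T.source, T v = H.slicePar (H.modelProj v) * H.slicePar (H.sliceProj v)) ∧
    (∀ v ∈ T.source, H.slicePar (H.sliceProj v) ∈ H.toSubgroup) := by
  obtain ⟨-, hat, h1, hF⟩ := H.slice_spec
  set c := H.sliceChart with hc
  have hcs := contMDiffOn_of_mem_maximalAtlas hat
  have hct := contMDiffOn_symm_of_mem_maximalAtlas hat
  have : IsTopologicalGroup G := topologicalGroup_of_lieGroup 𝓘(ℝ, E) ∞
  -- multiplication in the chart
  let a : E → E := fun v => c 1 + (H.modelProj v : E)
  let b : E → E := fun v => c 1 + (H.sliceProj v : E)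
  have ha : ContDiff ℝ ∞ a := contDiff_const.add (H.Model.subtypeL.comp H.modelProj).contDiff
  have hb : ContDiff ℝ ∞ b := contDiff_const.add (H.sliceSpace.subtypeL.comp H.sliceProj).contDiff
  let τ : E → G := fun v => c.symm (a v) * c.symm (b v)
  have hτ1 : τ 0 = 1 := by simp [τ, a, b, c.left_inv h1]
  let N0 : Set E := a ⁻¹' c.target ∩ b ⁻¹' c.target
  have hN0 : IsOpen N0 := (c.open_target.preimage ha.continuous).inter
    (c.open_target.preimage hb.continuous)
  have h0N0 : (0 : E) ∈ N0 := by simp [N0, a, b, c.map_source h1]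
  have hτ : ContMDiffOn 𝓘(ℝ, E) 𝓘(ℝ, E) ∞ τ N0 :=
    (hct.comp ha.contMDiff.contMDiffOn (fun x hx => hx.1)).mul
      (hct.comp hb.contMDiff.contMDiffOn (fun x hx => hx.2))
  let N1 : Set E := N0 ∩ τ ⁻¹' c.source
  have hN1 : IsOpen N1 := hτ.continuousOn.isOpen_inter_preimage hN0 c.open_source
  have h0N1 : (0 : E) ∈ N1 := ⟨h0N0, by simpa [hτ1] using h1⟩
  let Θ : E → E := c ∘ τ
  have hΘ : ContDiffOn ℝ ∞ Θ N1 := by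
    rw [← contMDiffOn_iff_contDiffOn]
    exact hcs.comp (hτ.mono inter_subset_left) (fun x hx => hx.2)
  have hΘ0 : HasFDerivAt Θ (ContinuousLinearMap.id ℝ E) 0 := by
    -- the derivative of the multiplication at the unit is the sum
    let D : Set (E × E) := c.target ×ˢ c.target
    let g : E × E → E := fun p => c (c.symm p.1 * c.symm p.2)
    have hp1 : c 1 ∈ c.target := c.map_source h1
    have hg : ContDiffAt ℝ ∞ g (c 1, c 1) := by
      rw [← contMDiffAt_iff_contDiffAt]
      have e1 : ContMDiffAt 𝓘(ℝ, E × E) 𝓘(ℝ, E) ∞ (fun p : E × E => c.symm p.1) (c 1, c 1) :=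
        ContMDiffAt.comp (c 1, c 1) (hct.contMDiffAt (c.open_target.mem_nhds hp1))
          contDiff_fst.contMDiff.contMDiffAt
      have e2 : ContMDiffAt 𝓘(ℝ, E × E) 𝓘(ℝ, E) ∞ (fun p : E × E => c.symm p.2) (c 1, c 1) :=
        ContMDiffAt.comp (c 1, c 1) (hct.contMDiffAt (c.open_target.mem_nhds hp1))
          contDiff_snd.contMDiff.contMDiffAt
      have e3 := e1.mul e2
      refine ContMDiffAt.comp (c 1, c 1) (hcs.contMDiffAt (c.open_source.mem_nhds ?_)) e3
      simpa [c.left_inv h1] using h1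
    have hgd := (hg.differentiableAt (by simp)).hasFDerivAt
    set L := fderiv ℝ g (c 1, c 1)
    have hl : HasFDerivAt (fun x : E => g (x, c 1)) (L.comp (.inl ℝ E E)) (c 1) :=
      HasFDerivAt.comp (f := fun x : E => (x, c 1)) (c 1) hgd (hasFDerivAt_prodMk_left (c 1) (c 1))
    have hr : HasFDerivAt (fun x : E => g (c 1, x)) (L.comp (.inr ℝ E E)) (c 1) :=
      HasFDerivAt.comp (f := fun x : E => (c 1, x)) (c 1) hgd (hasFDerivAt_prodMk_right (c 1) (c 1))
    have hl' : HasFDerivAt (fun x : E => g (x, c 1)) (.id ℝ E) (c 1) := by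
      refine (hasFDerivAt_id (c 1)).congr_of_eventuallyEq ?_
      filter_upwards [c.open_target.mem_nhds hp1] with x hx
      simp [g, c.left_inv h1, c.right_inv hx]
    have hr' : HasFDerivAt (fun x : E => g (c 1, x)) (.id ℝ E) (c 1) := by
      refine (hasFDerivAt_id (c 1)).congr_of_eventuallyEq ?_
      filter_upwards [c.open_target.mem_nhds hp1] with x hx
      simp [g, c.left_inv h1, c.right_inv hx]
    have el := hl.unique hl'
    have er := hr.unique hr'
    have ha' : HasFDerivAt a (H.Model.subtypeL.comp H.modelProj) 0 :=
      (H.Model.subtypeL.comp H.modelProj).hasFDerivAt.const_add _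
    have hb' : HasFDerivAt b (H.sliceSpace.subtypeL.comp H.sliceProj) 0 :=
      (H.sliceSpace.subtypeL.comp H.sliceProj).hasFDerivAt.const_add _
    have hgd' : HasFDerivAt g L (a 0, b 0) := by simpa [a, b] using hgd
    have := HasFDerivAt.comp (0 : E) hgd' (ha'.prodMk hb')
    change HasFDerivAt Θ _ 0 at this
    convert this using 1
    ext v
    have e1 := congrArg (fun A => A (H.modelProj v : E)) el
    have e2 := congrArg (fun A => A (H.sliceProj v : E)) er
    simp only [ContinuousLinearMap.comp_apply, ContinuousLinearMap.inl_apply,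
      ContinuousLinearMap.inr_apply, ContinuousLinearMap.id_apply] at e1 e2
    change v = L ((H.modelProj v : E), (H.sliceProj v : E))
    rw [show ((H.modelProj v : E), (H.sliceProj v : E)) =
      ((H.modelProj v : E), 0) + (0, (H.sliceProj v : E)) by simp, map_add, e1, e2,
      coe_modelProj]
    simp
  have hΘ0' : HasFDerivAt Θ ((ContinuousLinearEquiv.refl ℝ E : E ≃L[ℝ] E) : E →L[ℝ] E) 0 := hΘ0
  have hΘc : ContDiffAt ℝ ∞ Θ 0 := hΘ.contDiffAt (hN1.mem_nhds h0N1)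
  let K := hΘc.toOpenPartialHomeomorph Θ hΘ0' (by simp)
  have hK0 : (0 : E) ∈ K.source := hΘc.mem_toOpenPartialHomeomorph_source hΘ0' (by simp)
  let S : Set E := N1 ∩ fderiv ℝ Θ ⁻¹' range ((↑) : (E ≃L[ℝ] E) → E →L[ℝ] E)
  have hS : IsOpen S := (hΘ.continuousOn_fderiv_of_isOpen hN1 (by simp)).isOpen_inter_preimage hN1
    ContinuousLinearEquiv.isOpen
  have h0S : (0 : E) ∈ S := ⟨h0N1, ContinuousLinearEquiv.refl ℝ E, hΘ0'.fderiv.symm⟩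
  let K1 := K.restrOpen S hS
  let T := K1.trans c.symm
  have hTs : ∀ v ∈ T.source, v ∈ K.source ∧ v ∈ S := by
    intro v hv
    exact hv.1
  have hTτ : ∀ v ∈ T.source, T v = τ v := by
    intro v hv
    exact c.left_inv (hTs v hv).2.1.2
  refine ⟨T, ⟨⟨hK0, h0S⟩, c.map_source h0N1.2⟩, ?_, ?_, hTτ, ?_⟩
  · exact (hτ.mono fun v hv => (hTs v hv).2.1.1).congr hTτ
  · have hK1 : ContDiffOn ℝ ∞ K1.symm K1.target := by
      intro y hy
      have hx := K1.map_target hy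
      obtain ⟨A, hA⟩ := hx.2.2
      have hd : ContDiffAt ℝ ∞ Θ (K1.symm y) := hΘ.contDiffAt (hN1.mem_nhds hx.2.1)
      refine (K1.contDiffAt_symm (f₀' := A) hy ?_ hd).contDiffWithinAt
      rw [hA]
      exact (hd.differentiableAt (by simp)).hasFDerivAt
    refine (hK1.contMDiffOn.comp (hcs.mono ?_) ?_)
    · intro x hx; exact hx.1
    · intro x hx; exact hx.2
  · intro v hv
    have := (hTs v hv).2.1.1.2
    refine (hF _ (c.map_target this)).2 ?_
    rw [c.right_inv this]
    exact add_mem H.sliceChart_one_mem (H.sliceProj v).2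


/-- `s` is a smooth local section over the domain of the chart `e` of the quotient `G ⧸ H`, and
`e` is smooth as a map on `G`. -/
def IsSmoothSection (e : OpenPartialHomeomorph (G ⧸ H.toSubgroup) H.Model) (s : H.Model → G) :
    Prop :=
  ContMDiffOn 𝓘(ℝ, E) 𝓘(ℝ, H.Model) ∞ (fun g : G => e (QuotientGroup.mk g))
      {g | QuotientGroup.mk g ∈ e.source} ∧
    ContMDiffOn 𝓘(ℝ, H.Model) 𝓘(ℝ, E) ∞ s e.target ∧
    ∀ x ∈ e.target, (QuotientGroup.mk (s x) : G ⧸ H.toSubgroup) = e.symm x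

theorem exists_chart_one : ∃ (e : OpenPartialHomeomorph (G ⧸ H.toSubgroup) H.Model)
    (s : H.Model → G), (QuotientGroup.mk 1 : G ⧸ H.toSubgroup) ∈ e.source ∧
      H.IsSmoothSection e s := by
  have : IsTopologicalGroup G := topologicalGroup_of_lieGroup 𝓘(ℝ, E) ∞
  obtain ⟨T, h0, hT, hTi, hTeq, hTH⟩ := H.exists_tube
  obtain ⟨-, hat, h1, hF⟩ := H.slice_spec
  have hcs := contMDiffOn_of_mem_maximalAtlas hat
  have hTM : ∀ x : H.Model, (x : E) ∈ T.source → T x = H.slicePar x := by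
    intro x hx
    have h2 : H.sliceProj (x : E) = 0 := x.2
    rw [hTeq _ hx, H.modelProj_coe, h2]
    simp [slicePar_zero]
  let ψ : H.Model → G := fun x => H.slicePar x
  have hT1 : T 0 = 1 := by
    have := hTM 0 (by simpa using h0)
    simpa [slicePar_zero] using this
  -- neighbourhoods
  obtain ⟨A0, hA0, B, hB, hAB⟩ : ∃ A0 ∈ nhds (0 : E), ∃ B ∈ nhds (0 : E),
      ∀ x ∈ A0, ∀ y ∈ B, x + y ∈ T.source := by
    have : (fun p : E × E => p.1 + p.2) ⁻¹' T.source ∈ nhds ((0 : E), (0 : E)) :=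
      continuous_add.continuousAt.preimage_mem_nhds (T.open_source.mem_nhds (by simpa using h0))
    rw [nhds_prod_eq] at this
    obtain ⟨A0, hA0, B, hB, h⟩ := Filter.mem_prod_iff.1 this
    exact ⟨A0, hA0, B, hB, fun x hx y hy => h (show (x, y) ∈ A0 ×ˢ B from ⟨hx, hy⟩)⟩
  let N : Set G := H.sliceChart.source ∩ (fun g => H.sliceChart g - H.sliceChart 1) ⁻¹' B
  have hN : N ∈ nhds (1 : G) := by
    refine Filter.inter_mem (H.sliceChart.open_source.mem_nhds h1) ?_
    refine ContinuousAt.preimage_mem_nhds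
      ((H.sliceChart.continuousAt h1).sub continuousAt_const) (by simpa using hB)
  obtain ⟨A, hAo, hA0', hAT, hAA, hAN⟩ : ∃ A : Set H.Model, IsOpen A ∧ (0 : H.Model) ∈ A ∧
      (∀ x ∈ A, (x : E) ∈ T.source) ∧ (∀ x ∈ A, (x : E) ∈ A0) ∧
      ∀ x ∈ A, ∀ y ∈ A, (ψ x)⁻¹ * ψ y ∈ N := by
    have hc0 : ContinuousAt (fun x : H.Model => (x : E)) 0 := continuous_subtype_val.continuousAt
    have hs : ∀ᶠ x : H.Model in nhds 0, (x : E) ∈ T.source :=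
      hc0.preimage_mem_nhds (T.open_source.mem_nhds (by simpa using h0))
    have hψ : ContinuousAt ψ 0 := by
      have : ContinuousAt (fun x : H.Model => T (x : E)) 0 :=
        ContinuousAt.comp (f := fun x : H.Model => (x : E)) (g := T) (T.continuousAt (by simpa using h0)) hc0
      refine this.congr ?_
      filter_upwards [hs] with x hx using hTM x hx
    have hψ0 : ψ 0 = 1 := by simp [ψ, slicePar_zero]
    have h2 : ∀ᶠ p : H.Model × H.Model in nhds (0, 0), (ψ p.1)⁻¹ * ψ p.2 ∈ N := by
      have : ContinuousAt (fun p : H.Model × H.Model => (ψ p.1)⁻¹ * ψ p.2) (0, 0) :=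
        (ContinuousAt.inv (ContinuousAt.comp (f := Prod.fst) (x := ((0 : H.Model), (0 : H.Model))) hψ continuousAt_fst)).mul
          (ContinuousAt.comp (f := Prod.snd) (x := ((0 : H.Model), (0 : H.Model))) hψ continuousAt_snd)
      exact this.preimage_mem_nhds (by simpa [hψ0] using hN)
    rw [nhds_prod_eq] at h2
    obtain ⟨A1, hA1, A2, hA2, h3⟩ := Filter.mem_prod_iff.1 h2
    have h4 : ∀ᶠ x : H.Model in nhds 0, (x : E) ∈ T.source ∧ (x : E) ∈ A0 ∧ x ∈ A1 ∧ x ∈ A2 := by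
      filter_upwards [hs, hc0.preimage_mem_nhds (by simpa using hA0), hA1, hA2] with x a b c d
      exact ⟨a, b, c, d⟩
    obtain ⟨A, hA, hAo, h0A⟩ := eventually_nhds_iff.1 h4
    exact ⟨A, hAo, h0A, fun x hx => (hA x hx).1, fun x hx => (hA x hx).2.1,
      fun x hx y hy => h3 (show (x, y) ∈ A1 ×ˢ A2 from ⟨(hA x hx).2.2.1, (hA y hy).2.2.2⟩)⟩
  let f : H.Model → G ⧸ H.toSubgroup := fun x => QuotientGroup.mk (ψ x)
  have hinj : InjOn f A := by
    intro x hx x' hx' hxx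
    have hh : (ψ x)⁻¹ * ψ x' ∈ H.toSubgroup := QuotientGroup.eq.1 hxx
    obtain ⟨hm, hy⟩ := hAN x hx x' hx'
    set h := (ψ x)⁻¹ * ψ x' with hdef
    have hcF : H.sliceChart h - H.sliceChart 1 ∈ H.sliceSpace :=
      sub_mem ((hF h hm).1 hh) H.sliceChart_one_mem
    set y : H.sliceSpace := ⟨_, hcF⟩ with hydef
    have hψy : H.slicePar y = h := by
      simp [slicePar, hydef, H.sliceChart.left_inv hm]
    have hxy := hAB x (hAA x hx) y hy
    have e1 : T (x + y) = ψ x' := by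
      have h2 : H.sliceProj (x : E) = 0 := x.2
      rw [hTeq _ hxy, map_add, map_add, H.modelProj_coe, H.modelProj_slice, H.sliceProj_apply, h2,
        add_zero, zero_add, hψy]
      simp [ψ, hdef]
    have e2 : (x : E) + y = x' :=
      T.injOn hxy (hAT x' hx') (by rw [e1, hTM x' (hAT x' hx')])
    have := congrArg H.modelProj e2
    simpa [H.modelProj_coe, H.modelProj_slice] using this
  have hψA : ContMDiffOn 𝓘(ℝ, H.Model) 𝓘(ℝ, E) ∞ ψ A := by
    refine ContMDiffOn.congr (hT.comp H.Model.subtypeL.contDiff.contMDiff.contMDiffOn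
      (s := A) ?_) ?_
    · exact fun x hx => hAT x hx
    · exact fun x hx => (hTM x (hAT x hx)).symm
  have hfc : ContinuousOn f A := QuotientGroup.continuous_mk.comp_continuousOn hψA.continuousOn
  have hfo : ∀ V : Set H.Model, IsOpen V → V ⊆ A → IsOpen (f '' V) := by
    intro V hV hVA
    have h2 : IsOpen (T.source ∩ H.modelProj ⁻¹' V) :=
      T.open_source.inter (hV.preimage H.modelProj.continuous)
    have h3 : IsOpen (T '' (T.source ∩ H.modelProj ⁻¹' V)) :=
      T.isOpen_image_of_subset_source h2 inter_subset_left
    have h4 := QuotientGroup.isOpenMap_coe (N := H.toSubgroup) _ h3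
    convert h4 using 1
    ext z
    constructor
    · rintro ⟨x, hx, rfl⟩
      refine ⟨_, ⟨(x : E), ⟨hAT x (hVA hx), ?_⟩, rfl⟩, ?_⟩
      · simpa [H.modelProj_coe] using hx
      · rw [hTM x (hAT x (hVA hx))]
    · rintro ⟨_, ⟨v, ⟨hv, hvV⟩, rfl⟩, rfl⟩
      refine ⟨H.modelProj v, hvV, ?_⟩
      rw [hTeq v hv]
      exact (QuotientGroup.mk_mul_of_mem _ (hTH v hv)).symm
  let pe : PartialEquiv H.Model (G ⧸ H.toSubgroup) := hinj.toPartialEquiv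
  let oe : OpenPartialHomeomorph H.Model (G ⧸ H.toSubgroup) :=
    OpenPartialHomeomorph.ofContinuousOpenRestrict pe hfc (by
      intro W hW
      obtain ⟨V, hV, rfl⟩ := isOpen_induced_iff.1 hW
      have h2 := hfo (V ∩ A) (hV.inter hAo) inter_subset_right
      convert h2 using 1
      ext z
      constructor
      · rintro ⟨⟨x, hx⟩, hxV, rfl⟩
        exact ⟨x, ⟨hxV, hx⟩, rfl⟩
      · rintro ⟨x, ⟨hxV, hx⟩, rfl⟩
        exact ⟨⟨x, hx⟩, hxV, rfl⟩) hAo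
  refine ⟨oe.symm, ψ, ?_, ?_, hψA, fun x _ => rfl⟩
  · change (QuotientGroup.mk 1 : G ⧸ H.toSubgroup) ∈ f '' A
    exact ⟨0, hA0', by simp [f, ψ, slicePar_zero]⟩
  · intro p hp
    obtain ⟨x0, hx0, hpx⟩ : (QuotientGroup.mk p : G ⧸ H.toSubgroup) ∈ f '' A := hp
    have hh : (ψ x0)⁻¹ * p ∈ H.toSubgroup := QuotientGroup.eq.1 hpx
    set h := (ψ x0)⁻¹ * p with hdef
    have hp1 : p * h⁻¹ = T x0 := by simp [hdef, ψ, hTM x0 (hAT x0 hx0)]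
    have hp2 : p * h⁻¹ ∈ T.target := by rw [hp1]; exact T.map_source (hAT x0 hx0)
    have hp3 : T.symm (p * h⁻¹) = x0 := by rw [hp1, T.left_inv (hAT x0 hx0)]
    have hsm : ContMDiffAt 𝓘(ℝ, E) 𝓘(ℝ, E) ∞ (fun g : G => T.symm (g * h⁻¹)) p :=
      ContMDiffAt.comp p (hTi.contMDiffAt (T.open_target.mem_nhds hp2)) (contMDiff_mul_right.contMDiffAt)
    have hsm2 : ContMDiffAt 𝓘(ℝ, E) 𝓘(ℝ, H.Model) ∞
        (fun g : G => H.modelProj (T.symm (g * h⁻¹))) p :=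
      ContMDiffAt.comp p H.modelProj.contDiff.contMDiff.contMDiffAt hsm
    refine (hsm2.congr_of_eventuallyEq ?_).contMDiffWithinAt
    have ev1 : ∀ᶠ g in nhds p, g * h⁻¹ ∈ T.target :=
      (continuous_mul_const h⁻¹).continuousAt.preimage_mem_nhds (T.open_target.mem_nhds hp2)
    have ev2 : ∀ᶠ g in nhds p, H.modelProj (T.symm (g * h⁻¹)) ∈ A :=
      hsm2.continuousAt.preimage_mem_nhds (hAo.mem_nhds (by
        rw [hp3, H.modelProj_coe]; exact hx0))
    filter_upwards [ev1, ev2] with g hg1 hg2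
    have hv := T.map_target hg1
    have e1 : (QuotientGroup.mk g : G ⧸ H.toSubgroup) = f (H.modelProj (T.symm (g * h⁻¹))) := by
      have e2 : g * h⁻¹ = ψ (H.modelProj (T.symm (g * h⁻¹))) *
          H.slicePar (H.sliceProj (T.symm (g * h⁻¹))) := by
        rw [← hTeq _ hv, T.right_inv hg1]
      have e3 : (QuotientGroup.mk g : G ⧸ H.toSubgroup) = QuotientGroup.mk (g * h⁻¹) :=
        (QuotientGroup.mk_mul_of_mem _ (H.inv_mem hh)).symm
      rw [e3]
      conv_lhs => rw [e2]
      exact QuotientGroup.mk_mul_of_mem _ (hTH _ hv)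
    rw [e1]
    exact oe.left_inv hg2

theorem exists_chart (z : G ⧸ H.toSubgroup) :
    ∃ e : OpenPartialHomeomorph (G ⧸ H.toSubgroup) H.Model, z ∈ e.source ∧
      ∃ s : H.Model → G, H.IsSmoothSection e s := by
  have : IsTopologicalGroup G := topologicalGroup_of_lieGroup 𝓘(ℝ, E) ∞
  obtain ⟨e, s, h1, he, hs, hes⟩ := H.exists_chart_one
  obtain ⟨a, rfl⟩ := QuotientGroup.mk_surjective z
  refine ⟨(Homeomorph.smul (a⁻¹ : G)).toOpenPartialHomeomorph.trans e, ?_, fun x => a * s x,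
    ?_, ?_, ?_⟩
  · refine ⟨mem_univ _, ?_⟩
    change ((QuotientGroup.mk (a⁻¹ * a) : G ⧸ H.toSubgroup)) ∈ e.source
    simpa using h1
  · exact he.comp (s := {g | (QuotientGroup.mk (a⁻¹ * g) : G ⧸ H.toSubgroup) ∈ e.source})
      (contMDiff_mul_left (a := a⁻¹)).contMDiffOn (fun g hg => hg) |>.mono (fun g hg => hg.2)
  · refine ContMDiffOn.mono (contMDiff_mul_left.comp_contMDiffOn hs) ?_
    exact fun x hx => hx.1
  · intro x hx
    have h2 := hes x hx.1
    change (QuotientGroup.mk (a * s x) : G ⧸ H.toSubgroup) = (a⁻¹)⁻¹ • e.symm x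
    rw [← h2, inv_inv]
    rfl

/-- The canonical Banach manifold structure of `G ⧸ H`, for which the projection is a smooth
submersion: the charts are smooth as maps on `G`, and their inverses lift to smooth maps into
`G`. -/
noncomputable instance chartedSpace : ChartedSpace H.Model (G ⧸ H.toSubgroup) where
  atlas := {e | ∃ s : H.Model → G, H.IsSmoothSection e s}
  chartAt z := (H.exists_chart z).choose
  mem_chart_source z := (H.exists_chart z).choose_spec.1
  chart_mem_atlas z := (H.exists_chart z).choose_spec.2

instance isManifold : IsManifold 𝓘(ℝ, H.Model) ∞ (G ⧸ H.toSubgroup) := by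
  refine isManifold_of_contDiffOn _ _ _ ?_
  rintro e e' ⟨s, -, hs, hes⟩ ⟨s', he', -, -⟩
  simp only [modelWithCornersSelf_coe, modelWithCornersSelf_coe_symm, Function.comp_id,
    Function.id_comp, preimage_id, range_id, inter_univ]
  rw [← contMDiffOn_iff_contDiffOn]
  refine ContMDiffOn.congr (f := fun x => e' (QuotientGroup.mk (s x))) ?_ ?_
  · refine he'.comp (hs.mono fun x hx => hx.1) ?_
    intro x hx
    change QuotientGroup.mk (s x) ∈ e'.source
    rw [hes x hx.1]
    exact hx.2
  · intro x hx
    change e' (e.symm x) = _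
    rw [hes x hx.1]


/-- The Lie algebra of the subgroup, as a subspace of the Lie algebra of `G`: the velocities at `1`
of the smooth curves in `G` that run in the subgroup. -/
def lieAlgebra : Submodule ℝ (GroupLieAlgebra 𝓘(ℝ, E) G) where
  carrier := {X | ∃ c : ℝ → G, ContMDiff 𝓘(ℝ, ℝ) 𝓘(ℝ, E) ∞ c ∧ (∀ t, c t ∈ H.toSubgroup) ∧
    c 0 = 1 ∧ mfderiv 𝓘(ℝ, ℝ) 𝓘(ℝ, E) c 0 (1 : ℝ) = X}
  zero_mem' := ⟨fun _ => 1, contMDiff_const, fun _ => H.one_mem, rfl, by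
    rw [mfderiv_const]; rfl⟩
  add_mem' := by
    rintro _ _ ⟨c, hc, hcH, hc0, rfl⟩ ⟨d, hd, hdH, hd0, rfl⟩
    refine ⟨fun t => c t * d t, hc.mul hd, fun t => H.mul_mem (hcH t) (hdH t),
      by simp [hc0, hd0], ?_⟩
    have h1 : MDifferentiableAt (𝓘(ℝ, E).prod 𝓘(ℝ, E)) 𝓘(ℝ, E)
        (fun p : G × G => p.1 * p.2) (c 0, d 0) :=
      (contMDiff_mul 𝓘(ℝ, E) ∞).mdifferentiableAt (by simp)
    have hcd := (hc.mdifferentiable (by simp) 0)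
    have hdd := (hd.mdifferentiable (by simp) 0)
    have h2 := mfderiv_comp_apply (0 : ℝ) (f := fun t => (c t, d t))
      (g := fun p : G × G => p.1 * p.2) h1 (hcd.prodMk hdd) (1 : ℝ)
    have h3 := mfderiv_prod_eq_add_apply (v := mfderiv 𝓘(ℝ, ℝ) (𝓘(ℝ, E).prod 𝓘(ℝ, E))
      (fun t => (c t, d t)) 0 (1 : ℝ)) h1
    have e1 : (fun z : G => z * d 0) = id := by funext z; simp [hd0]
    have e2 : (fun z : G => c 0 * z) = id := by funext z; simp [hc0]
    have a1 : ∀ w : E, (mfderiv 𝓘(ℝ, E) 𝓘(ℝ, E) (fun z : G => z * d 0) (c 0) w : E) = w := by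
      intro w
      rw [e1, mfderiv_id]
      rfl
    have a2 : ∀ w : E, (mfderiv 𝓘(ℝ, E) 𝓘(ℝ, E) (fun z : G => c 0 * z) (d 0) w : E) = w := by
      intro w
      rw [e2, mfderiv_id]
      rfl
    rw [hcd.mfderiv_prod hdd] at h3 h2
    refine h2.trans (h3.trans ?_)
    exact congrArg₂ (fun x y : E => x + y) (a1 _) (a2 _)
  smul_mem' := by
    rintro a _ ⟨c, hc, hcH, hc0, rfl⟩
    have hm : ContMDiff 𝓘(ℝ, ℝ) 𝓘(ℝ, ℝ) ∞ (fun t : ℝ => a * t) :=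
      (contDiff_const.mul contDiff_id).contMDiff
    refine ⟨fun t => c (a * t), hc.comp hm, fun t => hcH _, by simp [hc0], ?_⟩
    have hd : HasFDerivAt (fun t : ℝ => a * t) (a • ContinuousLinearMap.id ℝ ℝ) 0 :=
      (hasFDerivAt_id (0 : ℝ)).const_mul a
    have h0 : a * (0 : ℝ) = 0 := mul_zero a
    have h1 : HasMFDerivAt 𝓘(ℝ, ℝ) 𝓘(ℝ, E) c (a * 0) (mfderiv 𝓘(ℝ, ℝ) 𝓘(ℝ, E) c (a * 0)) :=
      (hc.mdifferentiable (by simp) _).hasMFDerivAt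
    have h2 := (h1.comp (0 : ℝ) hd.hasMFDerivAt).mfderiv
    have h3 : mfderiv 𝓘(ℝ, ℝ) 𝓘(ℝ, E) (fun t => c (a * t)) 0 (1 : ℝ) =
        mfderiv 𝓘(ℝ, ℝ) 𝓘(ℝ, E) c (a * 0) (a • (1 : ℝ)) := congrArg (fun A => A (1 : ℝ)) h2
    rw [h3]
    have key : ∀ b : ℝ, b = 0 → (mfderiv 𝓘(ℝ, ℝ) 𝓘(ℝ, E) c b (a • (1 : ℝ)) : E) =
        a • (mfderiv 𝓘(ℝ, ℝ) 𝓘(ℝ, E) c 0 (1 : ℝ) : E) := by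
      rintro b rfl
      exact map_smul (mfderiv 𝓘(ℝ, ℝ) 𝓘(ℝ, E) c 0) a (1 : ℝ)
    exact key _ h0

end Model
end BanachLieSubgroup

/-- The representation data of a homogeneous vector bundle: a uniformly continuous unitary
representation `rep` of the Banach-Lie group `G` on the Hilbert space `K`, and a closed subspace
`sub` of `K` that is invariant under the Banach-Lie subgroup `H`. -/
structure HomogRep {E G : Type*} [NormedAddCommGroup E] [NormedSpace ℝ E]
    [TopologicalSpace G] [ChartedSpace E G] [Group G] (H : BanachLieSubgroup E G)
    (K : Type*) [NormedAddCommGroup K] [InnerProductSpace ℂ K] [CompleteSpace K] where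
  rep : G →* unitary (K →L[ℂ] K)
  continuous_rep : Continuous fun g => (rep g : K →L[ℂ] K)
  sub : Submodule ℂ K
  isClosed_sub : IsClosed (sub : Set K)
  rep_mem : ∀ w ∈ H.toSubgroup, ∀ f ∈ sub, (rep w : K →L[ℂ] K) f ∈ sub

namespace HomogRep

variable {E G K : Type*} [NormedAddCommGroup E] [NormedSpace ℝ E]
  [TopologicalSpace G] [ChartedSpace E G] [Group G] {H : BanachLieSubgroup E G}
  [NormedAddCommGroup K] [InnerProductSpace ℂ K] [CompleteSpace K] (ρ : HomogRep H K)

instance completeSpace_sub : CompleteSpace ρ.sub := ρ.isClosed_sub.completeSpace_coe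

/-- The operator `ρ(g)` on `K`. -/
noncomputable def act (g : G) : K →L[ℂ] K := (ρ.rep g : K →L[ℂ] K)

theorem act_one : ρ.act 1 = 1 := by simp [act]

theorem act_mul (g h : G) : ρ.act (g * h) = ρ.act g * ρ.act h := by simp [act]

theorem act_mul_apply (g h : G) (x : K) : ρ.act (g * h) x = ρ.act g (ρ.act h x) := by
  rw [act_mul]; rfl

theorem act_inv_act (g : G) (x : K) : ρ.act g⁻¹ (ρ.act g x) = x := by
  rw [← act_mul_apply, inv_mul_cancel, act_one]; rfl

theorem act_act_inv (g : G) (x : K) : ρ.act g (ρ.act g⁻¹ x) = x := by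
  rw [← act_mul_apply, mul_inv_cancel, act_one]; rfl

/-- The orthogonal projection of `K` onto `sub`. -/
noncomputable def P : K →L[ℂ] ρ.sub := ρ.sub.orthogonalProjectionOnto

/-- The equivalence relation `(g, f) ∼ (g w, ρ(w⁻¹) f)`, `w ∈ H`, on `G × sub`. -/
noncomputable def setoid : Setoid (G × ρ.sub) where
  r p q := ∃ w ∈ H.toSubgroup, q.1 = p.1 * w ∧ (q.2 : K) = ρ.act w⁻¹ p.2
  iseqv :=
    { refl := fun p => ⟨1, H.one_mem, by simp, by simp [act_one]⟩
      symm := by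
        rintro ⟨g, f⟩ ⟨g', f'⟩ ⟨w, hw, h1, h2⟩
        refine ⟨w⁻¹, H.inv_mem hw, ?_, ?_⟩
        · simp only at h1
          simp [h1]
        · simp only at h2
          simp [h2, act_act_inv]
      trans := by
        rintro ⟨g, f⟩ ⟨g', f'⟩ ⟨g'', f''⟩ ⟨w, hw, h1, h2⟩ ⟨v, hv, h3, h4⟩
        refine ⟨w * v, H.mul_mem hw hv, ?_, ?_⟩
        · simp only at h1 h3
          simp [h1, h3, mul_assoc]
        · simp only at h2 h4
          simp [h2, h4, act_mul_apply] }

/-- The total space `G ×_H sub` of the homogeneous vector bundle, with the quotient topology. -/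
def Total : Type _ := Quotient ρ.setoid

instance : TopologicalSpace ρ.Total := inferInstanceAs (TopologicalSpace (Quotient ρ.setoid))

/-- The class `[(g, f)]`. -/
noncomputable def cls (g : G) (f : ρ.sub) : ρ.Total := Quotient.mk ρ.setoid (g, f)

instance : Nonempty ρ.Total := ⟨ρ.cls 1 0⟩

theorem cls_mul (g : G) {w : G} (hw : w ∈ H.toSubgroup) (f f' : ρ.sub)
    (h : (f' : K) = ρ.act w⁻¹ f) : ρ.cls (g * w) f' = ρ.cls g f :=
  (Quotient.sound (s := ρ.setoid) ⟨w, hw, rfl, h⟩ :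
    Quotient.mk ρ.setoid (g, f) = Quotient.mk ρ.setoid (g * w, f')).symm

/-- The bundle projection `[(g, f)] ↦ gH`. -/
noncomputable def proj : ρ.Total → G ⧸ H.toSubgroup :=
  Quotient.lift (fun p => QuotientGroup.mk p.1) (by
    rintro ⟨g, f⟩ ⟨g', f'⟩ ⟨w, hw, h1, -⟩
    simp only at h1
    rw [h1]
    exact (QuotientGroup.mk_mul_of_mem _ hw).symm)

@[simp] theorem proj_cls (g : G) (f : ρ.sub) : ρ.proj (ρ.cls g f) = QuotientGroup.mk g := rfl

/-- The map `[(g, f)] ↦ ρ(g) f`. -/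
noncomputable def ev : ρ.Total → K :=
  Quotient.lift (fun p => ρ.act p.1 p.2) (by
    rintro ⟨g, f⟩ ⟨g', f'⟩ ⟨w, hw, h1, h2⟩
    simp only at h1 h2
    simp [h1, h2, act_mul_apply, act_act_inv])

@[simp] theorem ev_cls (g : G) (f : ρ.sub) : ρ.ev (ρ.cls g f) = ρ.act g f := rfl

/-- For `x` in the fibre over `aH`, the unique `f` with `x = [(a, f)]`. -/
noncomputable def coord (a : G) (x : ρ.Total) : ρ.sub := ρ.P (ρ.act a⁻¹ (ρ.ev x))

theorem coord_cls (a : G) (f : ρ.sub) : ρ.coord a (ρ.cls a f) = f := by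
  simp [coord, act_inv_act, P]

theorem cls_coord (a : G) (x : ρ.Total) (h : ρ.proj x = QuotientGroup.mk a) :
    ρ.cls a (ρ.coord a x) = x := by
  induction x using Quotient.ind with
  | _ p =>
  obtain ⟨g, f⟩ := p
  have hw : a⁻¹ * g ∈ H.toSubgroup := QuotientGroup.eq.1 h.symm
  obtain ⟨f', hf'⟩ : ∃ f' : ρ.sub, (f' : K) = ρ.act (a⁻¹ * g) f :=
    ⟨⟨_, ρ.rep_mem _ hw f f.2⟩, rfl⟩
  have e : ρ.cls a f' = ρ.cls g f := by
    have := ρ.cls_mul a hw f' f (by rw [hf', act_inv_act])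
    rw [← this, mul_inv_cancel_left]
  change ρ.cls a (ρ.coord a (ρ.cls g f)) = ρ.cls g f
  rw [← e, coord_cls]

/-- The point `x + t y` of the fibre of `x`, for `x` and `y` in the same fibre. -/
noncomputable def line (x y : ρ.Total) (t : ℝ) : ρ.Total :=
  ρ.cls (ρ.proj x).out (ρ.coord (ρ.proj x).out x + t • ρ.coord (ρ.proj x).out y)

theorem continuous_cls : Continuous fun p : G × ρ.sub => ρ.cls p.1 p.2 := continuous_quotient_mk'

theorem continuous_proj : Continuous ρ.proj :=
  Continuous.quotient_lift (s := ρ.setoid) (QuotientGroup.continuous_mk.comp continuous_fst) _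

theorem continuous_ev : Continuous ρ.ev :=
  Continuous.quotient_lift (s := ρ.setoid)
    ((ρ.continuous_rep.comp continuous_fst).clm_apply
      (continuous_subtype_val.comp continuous_snd)) _

variable [CompleteSpace E] [LieGroup 𝓘(ℝ, E) ∞ G]

/-- The bundle chart `[(g, f)] ↦ (y, f')` with `y = e(gH)` and `[(g, f)] = [(s(y), f')]`, given by
a smooth chart `e` of `G ⧸ H` and a smooth local section `s` over its domain. -/
noncomputable def bundleChart (e : OpenPartialHomeomorph (G ⧸ H.toSubgroup) H.Model)
    (s : H.Model → G) (hs : H.IsSmoothSection e s) :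
    OpenPartialHomeomorph ρ.Total (H.Model × ρ.sub) where
  toFun x := (e (ρ.proj x), ρ.coord (s (e (ρ.proj x))) x)
  invFun p := ρ.cls (s p.1) p.2
  source := ρ.proj ⁻¹' e.source
  target := e.target ×ˢ univ
  map_source' x hx := ⟨e.map_source hx, mem_univ _⟩
  map_target' p hp := by
    change (QuotientGroup.mk (s p.1) : G ⧸ H.toSubgroup) ∈ e.source
    rw [hs.2.2 _ hp.1]
    exact e.map_target hp.1
  left_inv' x hx := by
    refine ρ.cls_coord _ _ ?_
    rw [hs.2.2 _ (e.map_source hx), e.left_inv hx]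
  right_inv' p hp := by
    have h : e (ρ.proj (ρ.cls (s p.1) p.2)) = p.1 := by
      rw [proj_cls, hs.2.2 _ hp.1, e.right_inv hp.1]
    ext1
    · exact h
    · change ρ.coord (s (e (ρ.proj (ρ.cls (s p.1) p.2)))) (ρ.cls (s p.1) p.2) = p.2
      rw [h, coord_cls]
  open_source := e.open_source.preimage ρ.continuous_proj
  open_target := e.open_target.prod isOpen_univ
  continuousOn_toFun := by
    have : IsTopologicalGroup G := topologicalGroup_of_lieGroup 𝓘(ℝ, E) ∞
    have h1 : ContinuousOn (fun x => e (ρ.proj x)) (ρ.proj ⁻¹' e.source) :=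
      e.continuousOn.comp ρ.continuous_proj.continuousOn (fun x hx => hx)
    have h2 : ContinuousOn (fun x => s (e (ρ.proj x))) (ρ.proj ⁻¹' e.source) :=
      hs.2.1.continuousOn.comp h1 (fun x hx => e.map_source hx)
    have h3 : ContinuousOn (fun x => ρ.act (s (e (ρ.proj x)))⁻¹) (ρ.proj ⁻¹' e.source) :=
      ρ.continuous_rep.comp_continuousOn h2.inv
    exact h1.prodMk (ρ.P.continuous.comp_continuousOn (h3.clm_apply ρ.continuous_ev.continuousOn))
  continuousOn_invFun :=
    ρ.continuous_cls.comp_continuousOn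
      ((hs.2.1.continuousOn.comp continuousOn_fst fun p hp => hp.1).prodMk continuousOn_snd)

/-- The canonical manifold structure of `G ×_H sub`, given by the bundle charts. (The transition
maps are smooth since a norm continuous representation of a Banach-Lie group is smooth.) -/
noncomputable instance chartedSpace : ChartedSpace (H.Model × ρ.sub) ρ.Total where
  atlas := {c | ∃ e s, ∃ hs : H.IsSmoothSection e s, c = ρ.bundleChart e s hs}
  chartAt x := ρ.bundleChart (H.exists_chart (ρ.proj x)).choose
    (H.exists_chart (ρ.proj x)).choose_spec.2.choose
    (H.exists_chart (ρ.proj x)).choose_spec.2.choose_spec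
  mem_chart_source x := (H.exists_chart (ρ.proj x)).choose_spec.1
  chart_mem_atlas x := ⟨_, _, (H.exists_chart (ρ.proj x)).choose_spec.2.choose_spec, rfl⟩

/-- The derived representation `dρ(X)`. -/
noncomputable def deriv (X : GroupLieAlgebra 𝓘(ℝ, E) G) : K →L[ℂ] K :=
  mfderiv 𝓘(ℝ, E) 𝓘(ℝ, K →L[ℂ] K) ρ.act 1 X

/-- The derivative `dφ(u, X)` of `φ : G → sub` in the direction of the left translate to `u` of the
vector `X` of the Lie algebra. -/
noncomputable def leftDeriv (φ : G → ρ.sub) (u : G) (X : GroupLieAlgebra 𝓘(ℝ, E) G) : ρ.sub :=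
  mfderiv 𝓘(ℝ, E) 𝓘(ℝ, ρ.sub) φ u (mulInvariantVectorField X u)

/-- The tangent vector `[((g, X), (f, h))]` of `G ×_H sub`: the image of the tangent vector
`(gX, h)` of `G × sub` at `(g, f)` under the tangent map of the quotient map. -/
noncomputable def tangentClass (g : G) (X : GroupLieAlgebra 𝓘(ℝ, E) G) (f h : ρ.sub) :
    TangentBundle 𝓘(ℝ, H.Model × ρ.sub) ρ.Total :=
  tangentMap (𝓘(ℝ, E).prod 𝓘(ℝ, ρ.sub)) 𝓘(ℝ, H.Model × ρ.sub)
    (fun p : G × ρ.sub => ρ.cls p.1 p.2) ⟨(g, f), (mulInvariantVectorField X g, h)⟩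

/-- The natural connection `[((g, X), (f, h))] ↦ [((g, 0), (f, P(dρ(X) f) + h))]`. -/
noncomputable def natConn (v : TangentBundle 𝓘(ℝ, H.Model × ρ.sub) ρ.Total) :
    TangentBundle 𝓘(ℝ, H.Model × ρ.sub) ρ.Total :=
  let p := invFun (fun p : (G × GroupLieAlgebra 𝓘(ℝ, E) G) × (ρ.sub × ρ.sub) =>
    ρ.tangentClass p.1.1 p.1.2 p.2.1 p.2.2) v
  ρ.tangentClass p.1.1 0 p.2.1 (ρ.P (ρ.deriv p.1.2 p.2.1) + p.2.2)

/-- The fibred product of the bundle with itself. -/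
def FibProd : Type _ := {p : ρ.Total × ρ.Total // ρ.proj p.1 = ρ.proj p.2}

instance : Nonempty ρ.FibProd := ⟨⟨(ρ.cls 1 0, ρ.cls 1 0), rfl⟩⟩

/-- The map `(x, y) ↦ d/dt|_{t = 0} (x + t y)`, which identifies the fibred product with the
vertical part of the tangent bundle. -/
noncomputable def vert (p : ρ.FibProd) : TangentBundle 𝓘(ℝ, H.Model × ρ.sub) ρ.Total :=
  tangentMap 𝓘(ℝ, ℝ) 𝓘(ℝ, H.Model × ρ.sub) (ρ.line p.1.1 p.1.2) ⟨0, (1 : ℝ)⟩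

/-- The map `r` from vertical vectors to the bundle: the vertical vector
`d/dt|_{t = 0} (x + t y)` goes to `y` (a junk value is assigned to vectors that are not
vertical). -/
noncomputable def vertProj (v : TangentBundle 𝓘(ℝ, H.Model × ρ.sub) ρ.Total) : ρ.Total :=
  (invFun ρ.vert v).1.2

/-- The covariant derivative `∇σ = r ∘ Φ ∘ Tσ` of a section `σ` for a connection `Φ`. -/
noncomputable def covDeriv (Φ : TangentBundle 𝓘(ℝ, H.Model × ρ.sub) ρ.Total →
    TangentBundle 𝓘(ℝ, H.Model × ρ.sub) ρ.Total) (σ : G ⧸ H.toSubgroup → ρ.Total)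
    (v : TangentBundle 𝓘(ℝ, H.Model) (G ⧸ H.toSubgroup)) : ρ.Total :=
  ρ.vertProj (Φ (tangentMap 𝓘(ℝ, H.Model) 𝓘(ℝ, H.Model × ρ.sub) σ v))

/-- The section `gH ↦ [(g, φ(g))]` defined by an equivariant map `φ`. -/
noncomputable def homogSection (φ : G → ρ.sub)
    (hφ : ∀ u : G, ∀ w ∈ H.toSubgroup, (φ (u * w) : K) = ρ.act w⁻¹ (φ u)) :
    G ⧸ H.toSubgroup → ρ.Total :=
  Quotient.lift (s := QuotientGroup.leftRel H.toSubgroup) (fun u => ρ.cls u (φ u)) (by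
    intro a b hab
    have hw : a⁻¹ * b ∈ H.toSubgroup := QuotientGroup.leftRel_apply.1 hab
    have h := hφ a _ hw
    rw [mul_inv_cancel_left] at h
    have e := ρ.cls_mul a hw (φ a) (φ b) h
    rw [mul_inv_cancel_left] at e
    exact e.symm)

end HomogRep

/-- The tangent vector of `G ⧸ H` denoted by `[(u, X)]`: the image of the left translate `uX` of
the vector `X` of the Lie algebra under the tangent map of the projection `G → G ⧸ H`. -/
noncomputable def BanachLieSubgroup.baseTangent {E G : Type*} [NormedAddCommGroup E]
    [NormedSpace ℝ E] [CompleteSpace E] [TopologicalSpace G] [ChartedSpace E G] [Group G]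
    [LieGroup 𝓘(ℝ, E) ∞ G] (H : BanachLieSubgroup E G) (u : G)
    (X : GroupLieAlgebra 𝓘(ℝ, E) G) : TangentBundle 𝓘(ℝ, H.Model) (G ⧸ H.toSubgroup) :=
  tangentMap 𝓘(ℝ, E) 𝓘(ℝ, H.Model) (QuotientGroup.mk : G → G ⧸ H.toSubgroup)
    ⟨u, mulInvariantVectorField X u⟩

section LocalHom

open Filter Topology

variable {E F A : Type*} [NormedAddCommGroup E] [NormedSpace ℝ E]
  [NormedAddCommGroup F] [NormedSpace ℝ F] [NormedRing A] [NormedAlgebra ℝ A]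

/-- The mixed second difference of a `C^2` map is bounded by the product of the increments. -/
theorem ContDiffAt.exists_mixed_difference_le {m : E × E → F} (hm : ContDiffAt ℝ 2 m (0, 0)) :
    ∃ C > (0 : ℝ), ∃ r > (0 : ℝ), ∀ x y, ‖x‖ < r → ‖y‖ < r →
      ‖m (x, y) - m (0, y) - (m (x, 0) - m (0, 0))‖ ≤ C * ‖x‖ * ‖y‖ := by
  have h1 : ContDiffAt ℝ 1 (fderiv ℝ m) (0, 0) := hm.fderiv_right (by norm_num)
  obtain ⟨K, t, ht, hK⟩ := h1.exists_lipschitzOnWith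
  have h2 : ∀ᶠ p in 𝓝 ((0 : E), (0 : E)), DifferentiableAt ℝ m p := by
    filter_upwards [hm.eventually (by simp)] with p hp
    exact hp.differentiableAt (by norm_num)
  obtain ⟨r, hr, hb⟩ := Metric.mem_nhds_iff.1 (inter_mem ht h2)
  have hmem : ∀ x y : E, ‖x‖ < r → ‖y‖ < r → (x, y) ∈ t ∩ {p | DifferentiableAt ℝ m p} := by
    intro x y hx hy
    apply hb
    rw [← Prod.zero_eq_mk, mem_ball_zero_iff, Prod.norm_def]
    exact max_lt hx hy
  refine ⟨K + 1, by positivity, r, hr, fun x y hx hy => ?_⟩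
  have h0 : ‖(0 : E)‖ < r := by simpa using hr
  have key := (convex_ball (0 : E) r).norm_image_sub_le_of_norm_hasFDerivWithin_le
    (f := fun y => m (x, y) - m (0, y))
    (f' := fun y => (fderiv ℝ m (x, y) - fderiv ℝ m (0, y)).comp (.inr ℝ E E))
    (C := (K + 1) * ‖x‖) (x := 0) (y := y) ?_ ?_ (by simpa using hr) (by simpa using hy)
  · simpa [sub_zero] using key
  · intro y hy
    rw [mem_ball_zero_iff] at hy
    have e1 := (hmem x y hx hy).2.hasFDerivAt.comp y (hasFDerivAt_prodMk_right x y)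
    have e2 := (hmem 0 y h0 hy).2.hasFDerivAt.comp y (hasFDerivAt_prodMk_right 0 y)
    rw [ContinuousLinearMap.sub_comp]
    exact (e1.sub e2).hasFDerivWithinAt
  · intro y hy
    rw [mem_ball_zero_iff] at hy
    have e := hK.norm_sub_le (hmem x y hx hy).1 (hmem 0 y h0 hy).1
    have e' : ‖((x, y) : E × E) - (0, y)‖ = ‖x‖ := by simp [Prod.norm_def]
    rw [e'] at e
    calc _ ≤ ‖fderiv ℝ m (x, y) - fderiv ℝ m (0, y)‖ * ‖ContinuousLinearMap.inr ℝ E E‖ :=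
          ContinuousLinearMap.opNorm_comp_le _ _
      _ ≤ (K * ‖x‖) * 1 := by
          gcongr
          exact ContinuousLinearMap.norm_inr_le_one ℝ E E
      _ ≤ (K + 1) * ‖x‖ := by nlinarith [norm_nonneg x]

/-- If the powers of `a` up to the `n`-th stay `1 / 2`-close to `1`, then `a` is `1 / n`-close to
`1`. -/
theorem norm_sub_one_mul_le_of_pow (a : A) (n : ℕ) (h : ∀ k ≤ n, ‖a ^ k - 1‖ ≤ 1 / 2) :
    n * ‖a - 1‖ ≤ 1 := by
  have e : (n : ℝ) • (a - 1) =
      (a ^ n - 1) - (∑ k ∈ Finset.range n, (a ^ k - 1)) * (a - 1) := by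
    rw [Finset.sum_sub_distrib, sub_mul, geom_sum_mul]
    simp [Nat.cast_smul_eq_nsmul]
  have h1 : ‖∑ k ∈ Finset.range n, (a ^ k - 1)‖ ≤ n * (1 / 2) := by
    refine (norm_sum_le_of_le _ fun k hk => h k (Finset.mem_range.1 hk).le).trans ?_
    simp
  have h2 : ‖(n : ℝ) • (a - 1)‖ ≤ 1 / 2 + n * (1 / 2) * ‖a - 1‖ := by
    rw [e]
    refine (norm_sub_le _ _).trans (add_le_add (h n le_rfl) ((norm_mul_le _ _).trans ?_))
    gcongr
  rw [norm_smul, Real.norm_natCast] at h2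
  linarith

omit [NormedSpace ℝ E] in
/-- A continuous local homomorphism into a normed algebra is Lipschitz at the unit. -/
theorem exists_norm_sub_one_le_of_local_hom {f : E → A} {m : E × E → E} {C r : ℝ}
    (hC : 0 < C) (hr : 0 < r)
    (hm : ∀ x y, ‖x‖ < r → ‖y‖ < r → ‖m (x, y) - (x + y)‖ ≤ C * ‖x‖ * ‖y‖)
    (hf : ∀ x y, ‖x‖ < r → ‖y‖ < r → f (m (x, y)) = f x * f y)
    (hf0 : f 0 = 1) (hfc : ContinuousAt f 0) :
    ∃ M > (0 : ℝ), ∃ δ > (0 : ℝ), ∀ x, ‖x‖ < δ → ‖f x - 1‖ ≤ M * ‖x‖ := by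
  obtain ⟨δ₁, hδ₁, h1⟩ : ∃ δ > (0 : ℝ), ∀ x, ‖x‖ < δ → ‖f x - 1‖ ≤ 1 / 2 := by
    obtain ⟨δ, hδ, h⟩ := Metric.continuousAt_iff.1 hfc (1 / 2) (by norm_num)
    refine ⟨δ, hδ, fun x hx => ?_⟩
    have := h (by simpa using hx)
    rw [hf0, dist_eq_norm] at this
    exact this.le
  obtain ⟨δ, hδ, hδr, hδC, hδδ⟩ : ∃ δ > 0, δ ≤ r ∧ C * δ ≤ 1 ∧ δ ≤ δ₁ := by
    refine ⟨min (min r (1 / C)) δ₁, by positivity, (min_le_left _ _).trans (min_le_left _ _), ?_,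
      min_le_right _ _⟩
    calc C * min (min r (1 / C)) δ₁ ≤ C * (1 / C) := by
          gcongr; exact (min_le_left _ _).trans (min_le_right _ _)
      _ = 1 := by field_simp
  have hpow : ∀ x : E, ‖x‖ < δ → ∀ n : ℕ, 2 * n * ‖x‖ < δ →
      ∃ y, ‖y‖ ≤ 2 * n * ‖x‖ ∧ f y = f x ^ n := by
    intro x hx n
    induction n with
    | zero => intro _; exact ⟨0, by simp, by simp [hf0]⟩
    | succ n ih =>
      intro hn
      push_cast at hn
      have hx0 := norm_nonneg x
      obtain ⟨y, hy, hfy⟩ := ih (by linarith)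
      have hyδ : ‖y‖ < δ := by linarith
      have hb := hm y x (by linarith) (by linarith)
      refine ⟨m (y, x), ?_, by rw [hf y x (by linarith) (by linarith), hfy, pow_succ]⟩
      have h3 : ‖m (y, x)‖ ≤ ‖m (y, x) - (y + x)‖ + (‖y‖ + ‖x‖) := by
        have := norm_add_le (m (y, x) - (y + x)) (y + x)
        rw [sub_add_cancel] at this
        linarith [norm_add_le y x]
      have h4 : C * ‖y‖ ≤ 1 := (by gcongr : C * ‖y‖ ≤ C * δ).trans hδC
      have h5 : C * ‖y‖ * ‖x‖ ≤ 1 * ‖x‖ := by gcongr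
      push_cast
      linarith
  refine ⟨4 / δ, by positivity, δ / 4, by positivity, fun x hx => ?_⟩
  rcases eq_or_ne x 0 with rfl | hne
  · simp [hf0]
  have hx0 : 0 < ‖x‖ := norm_pos_iff.2 hne
  set n := ⌊δ / (4 * ‖x‖)⌋₊ + 1 with hn
  have hn1 : δ / (4 * ‖x‖) < n := by rw [hn]; push_cast; exact Nat.lt_floor_add_one _
  have hn2 : (n : ℝ) ≤ δ / (4 * ‖x‖) + 1 := by
    rw [hn]; push_cast
    gcongr
    exact Nat.floor_le (by positivity)
  have hn3 : 2 * n * ‖x‖ < δ := by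
    have : 2 * n * ‖x‖ ≤ 2 * (δ / (4 * ‖x‖) + 1) * ‖x‖ := by gcongr
    have e : 2 * (δ / (4 * ‖x‖) + 1) * ‖x‖ = δ / 2 + 2 * ‖x‖ := by field_simp; ring
    linarith
  have key := norm_sub_one_mul_le_of_pow (f x) n (fun k hk => by
    have hk' : 2 * (k : ℝ) * ‖x‖ ≤ 2 * n * ‖x‖ := by gcongr
    obtain ⟨y, hy, hfy⟩ := hpow x (by linarith) k (by linarith)
    rw [← hfy]
    exact h1 y (by linarith))
  have h6 : δ / (4 * ‖x‖) * ‖f x - 1‖ ≤ 1 := le_trans (by gcongr) key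
  rw [div_mul_eq_mul_div, div_le_one (by positivity)] at h6
  rw [div_mul_eq_mul_div, le_div_iff₀ hδ]
  linarith

/-- A map that is additive near `0` up to a quadratic error, and Lipschitz at `0`, is
differentiable at `0`. -/
theorem exists_hasFDerivAt_of_almost_additive [CompleteSpace F] {a : E → F} {M Q δ : ℝ}
    (hQ : 0 ≤ Q) (hδ : 0 < δ) (hM : ∀ x, ‖x‖ < δ → ‖a x‖ ≤ M * ‖x‖)
    (ha : ∀ x y, ‖x‖ < δ → ‖y‖ < δ → ‖a (x + y) - (a x + a y)‖ ≤ Q * ‖x‖ * ‖y‖) :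
    ∃ T : E →L[ℝ] F, HasFDerivAt a T 0 := by
  let u : E → ℕ → F := fun x n => (2 : ℝ) ^ n • a (((2 : ℝ)⁻¹ ^ n) • x)
  have hnorm : ∀ (x : E) (n : ℕ), ‖((2 : ℝ)⁻¹ ^ n) • x‖ = (2 : ℝ)⁻¹ ^ n * ‖x‖ := by
    intro x n
    rw [norm_smul, norm_pow, norm_inv, Real.norm_ofNat]
  have hsmall : ∀ x : E, ∀ᶠ n : ℕ in atTop, ‖((2 : ℝ)⁻¹ ^ n) • x‖ < δ := by
    intro x
    have : Tendsto (fun n : ℕ => (2 : ℝ)⁻¹ ^ n * ‖x‖) atTop (𝓝 (0 * ‖x‖)) :=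
      (tendsto_pow_atTop_nhds_zero_of_lt_one (by norm_num) (by norm_num)).mul_const _
    rw [zero_mul] at this
    filter_upwards [this.eventually_lt_const hδ] with n hn
    rwa [hnorm]
  have hstep : ∀ x : E, ‖x‖ < δ → ∀ n, dist (u x n) (u x (n + 1)) ≤ (Q * ‖x‖ ^ 2) / 2 / 2 ^ n := by
    intro x hx n
    set y := ((2 : ℝ)⁻¹ ^ (n + 1)) • x with hy
    have hyn : ‖y‖ = (2 : ℝ)⁻¹ ^ (n + 1) * ‖x‖ := hnorm x _
    have hyδ : ‖y‖ < δ := by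
      rw [hyn]
      have : (2 : ℝ)⁻¹ ^ (n + 1) ≤ 1 := pow_le_one₀ (by norm_num) (by norm_num)
      nlinarith [norm_nonneg x]
    have h2y : ((2 : ℝ)⁻¹ ^ n) • x = y + y := by
      rw [hy, ← add_smul, pow_succ]; congr 1; ring
    have e : u x n - u x (n + 1) = (2 : ℝ) ^ n • (a (y + y) - (a y + a y)) := by
      simp only [u]
      rw [h2y, ← hy, pow_succ, mul_smul, two_smul, smul_sub]
    rw [dist_eq_norm, e, norm_smul, norm_pow, Real.norm_ofNat]
    calc (2 : ℝ) ^ n * ‖a (y + y) - (a y + a y)‖ ≤ 2 ^ n * (Q * ‖y‖ * ‖y‖) := by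
          gcongr; exact ha y y hyδ hyδ
      _ = (Q * ‖x‖ ^ 2) / 4 / 2 ^ n := by
          rw [hyn, inv_pow, pow_succ]; field_simp; ring
      _ ≤ _ := by gcongr; norm_num
  have hlim0 : ∀ x : E, ‖x‖ < δ → ∃ l, Tendsto (u x) atTop (𝓝 l) := fun x hx =>
    cauchySeq_tendsto_of_complete (cauchySeq_of_le_geometric_two (hstep x hx))
  have hlim : ∀ x : E, ∃ l, Tendsto (u x) atTop (𝓝 l) := by
    intro x
    obtain ⟨N, hN⟩ := (hsmall x).exists
    obtain ⟨l, hl⟩ := hlim0 _ hN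
    refine ⟨(2 : ℝ) ^ N • l, (tendsto_add_atTop_iff_nat N).1 ?_⟩
    refine (hl.const_smul ((2 : ℝ) ^ N)).congr fun n => ?_
    simp only [u, smul_smul, ← pow_add, add_comm N n]
  choose T hT using hlim
  have hTadd : ∀ x y, T (x + y) = T x + T y := by
    intro x y
    refine eq_of_sub_eq_zero (tendsto_nhds_unique ((hT (x + y)).sub ((hT x).add (hT y))) ?_)
    have hz : Tendsto (fun n : ℕ => (2 : ℝ)⁻¹ ^ n * (Q * ‖x‖ * ‖y‖)) atTop
        (𝓝 (0 * (Q * ‖x‖ * ‖y‖))) :=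
      (tendsto_pow_atTop_nhds_zero_of_lt_one (by norm_num) (by norm_num)).mul_const _
    rw [zero_mul] at hz
    refine squeeze_zero_norm' ?_ hz
    filter_upwards [hsmall x, hsmall y] with n hx hy
    have h := ha _ _ hx hy
    rw [hnorm, hnorm] at h
    simp only [u, ← smul_add, ← smul_sub]
    rw [smul_add ((2 : ℝ)⁻¹ ^ n), norm_smul, norm_pow, Real.norm_ofNat]
    calc _ ≤ (2 : ℝ) ^ n * (Q * ((2 : ℝ)⁻¹ ^ n * ‖x‖) * ((2 : ℝ)⁻¹ ^ n * ‖y‖)) := by gcongr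
      _ = _ := by rw [inv_pow]; field_simp
  have hTM : ∀ x, ‖T x‖ ≤ M * ‖x‖ := by
    intro x
    refine le_of_tendsto (hT x).norm ?_
    filter_upwards [hsmall x] with n hn
    have h := hM _ hn
    rw [hnorm] at h
    simp only [u]
    rw [norm_smul, norm_pow, Real.norm_ofNat]
    calc _ ≤ (2 : ℝ) ^ n * (M * ((2 : ℝ)⁻¹ ^ n * ‖x‖)) := by gcongr
      _ = _ := by rw [inv_pow]; field_simp
  let T₁ : E →+ F := AddMonoidHom.mk' T hTadd
  have hTc : Continuous T₁ := AddMonoidHomClass.continuous_of_bound T₁ M hTM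
  refine ⟨T₁.toRealLinearMap hTc, ?_⟩
  have ha0 : a 0 = 0 := by simpa using hM 0 (by simpa using hδ)
  rw [hasFDerivAt_iff_isLittleO_nhds_zero]
  have hO : (fun h => a (0 + h) - a 0 - (T₁.toRealLinearMap hTc) h) =O[𝓝 0]
      fun h : E => ‖h‖ ^ 2 := by
    refine Asymptotics.IsBigO.of_bound Q ?_
    filter_upwards [Metric.ball_mem_nhds (0 : E) hδ] with x hx
    rw [mem_ball_zero_iff] at hx
    have h := dist_le_of_le_geometric_two_of_tendsto₀ (hstep x hx) (hT x)
    have e : u x 0 = a x := by simp [u]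
    rw [e, dist_eq_norm] at h
    rw [ha0, zero_add, sub_zero, norm_pow, norm_norm]
    exact h
  exact hO.trans_isLittleO (Asymptotics.isLittleO_norm_pow_id (by norm_num))

/-- A continuous local homomorphism into a Banach algebra is differentiable at the unit. Here `m`
is the local multiplication and `d (x, y)` is the local expression of `x⁻¹ y`. -/
theorem exists_hasFDerivAt_of_local_hom [CompleteSpace A] {f : E → A} {m d : E × E → E}
    (hm : ContDiffAt ℝ 2 m (0, 0)) (hm0 : ∀ᶠ x in 𝓝 0, m (x, 0) = x)
    (h0m : ∀ᶠ y in 𝓝 0, m (0, y) = y)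
    (hfm : ∀ᶠ p in 𝓝 ((0 : E), (0 : E)), f (m p) = f p.1 * f p.2)
    (hd : ContDiffAt ℝ 1 d (0, 0)) (hdd : ∀ᶠ x in 𝓝 0, d (x, x) = 0)
    (hfd : ∀ᶠ p in 𝓝 ((0 : E), (0 : E)), f p.2 = f p.1 * f (d p))
    (hf0 : f 0 = 1) (hfc : ContinuousAt f 0) :
    ∃ T : E →L[ℝ] A, HasFDerivAt f T 0 := by
  obtain ⟨C, hC, r₁, hr₁, hCm⟩ := hm.exists_mixed_difference_le
  obtain ⟨K, t, ht, hK⟩ := hd.exists_lipschitzOnWith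
  obtain ⟨r₂, hr₂, h2⟩ := Metric.eventually_nhds_iff.1 (hm0.and (h0m.and hdd))
  obtain ⟨r₃, hr₃, h3⟩ := Metric.eventually_nhds_iff.1 (hfm.and (hfd.and ht))
  obtain ⟨r, hr, hrr₁, hrr₂, hrr₃⟩ : ∃ r > 0, r ≤ r₁ ∧ r ≤ r₂ ∧ r ≤ r₃ :=
    ⟨min r₁ (min r₂ r₃), by positivity, min_le_left _ _, (min_le_right _ _).trans (min_le_left _ _),
      (min_le_right _ _).trans (min_le_right _ _)⟩
  have H1 : ∀ x, ‖x‖ < r → m (x, 0) = x ∧ m (0, x) = x ∧ d (x, x) = 0 := fun x hx =>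
    h2 (by rw [dist_zero_right]; exact hx.trans_le hrr₂)
  have H2 : ∀ x y, ‖x‖ < r → ‖y‖ < r →
      f (m (x, y)) = f x * f y ∧ f y = f x * f (d (x, y)) ∧ t (x, y) := fun x y hx hy =>
    h3 (y := (x, y)) (by
      rw [← Prod.zero_eq_mk, dist_zero_right, Prod.norm_def]
      exact max_lt (hx.trans_le hrr₃) (hy.trans_le hrr₃))
  have hm00 : m (0, 0) = 0 := (H1 0 (by simpa using hr)).1
  have hbm : ∀ x y, ‖x‖ < r → ‖y‖ < r → ‖m (x, y) - (x + y)‖ ≤ C * ‖x‖ * ‖y‖ := by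
    intro x y hx hy
    have h := hCm x y (hx.trans_le hrr₁) (hy.trans_le hrr₁)
    rw [(H1 x hx).1, (H1 y hy).2.1, hm00, sub_zero] at h
    rwa [add_comm x y, ← sub_sub]
  have hbd : ∀ x y, ‖x‖ < r → ‖y‖ < r → ‖d (x, y)‖ ≤ K * ‖y - x‖ := by
    intro x y hx hy
    have h := hK.norm_sub_le (H2 x y hx hy).2.2 (H2 x x hx hx).2.2
    rw [(H1 x hx).2.2, sub_zero] at h
    simpa [Prod.norm_def] using h
  obtain ⟨M, hM, δ₀, hδ₀, hL⟩ := exists_norm_sub_one_le_of_local_hom hC hr hbm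
    (fun x y hx hy => (H2 x y hx hy).1) hf0 hfc
  obtain ⟨δ, hδ, hδC, hδr, hδδ, hδK, hδM⟩ : ∃ δ > 0, C * δ ≤ 1 ∧ 3 * δ ≤ r ∧ δ ≤ δ₀ ∧
      (K + 1) * (3 * δ) ≤ δ₀ ∧ M * (3 * δ) ≤ 1 := by
    have ev : ∀ᶠ δ in 𝓝[>] (0 : ℝ), C * δ ≤ 1 ∧ 3 * δ ≤ r ∧ δ ≤ δ₀ ∧
        (K + 1) * (3 * δ) ≤ δ₀ ∧ M * (3 * δ) ≤ 1 := by
      refine nhdsWithin_le_nhds ?_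
      have aux : ∀ (g : ℝ → ℝ) (b : ℝ), Continuous g → g 0 = 0 → 0 < b →
          ∀ᶠ δ in 𝓝 (0 : ℝ), g δ ≤ b := fun g b hg h0 hb => by
        filter_upwards [hg.continuousAt.eventually_lt_const (by rwa [h0] : g 0 < b)] with x hx
        exact hx.le
      exact (aux _ _ (by fun_prop) (by simp) one_pos).and
        ((aux _ _ (by fun_prop) (by simp) hr).and ((aux _ _ (by fun_prop) (by simp) hδ₀).and
        ((aux _ _ (by fun_prop) (by simp) hδ₀).and (aux _ _ (by fun_prop) (by simp) one_pos))))
    obtain ⟨δ, h, hδ⟩ := (ev.and self_mem_nhdsWithin).exists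
    exact ⟨δ, hδ, h⟩
  have hadd : ∀ x y, ‖x‖ < δ → ‖y‖ < δ → ‖f (x + y) - 1 - (f x - 1 + (f y - 1))‖ ≤
      ((‖(1 : A)‖ + 1) * (M * (K * C)) + M * M) * ‖x‖ * ‖y‖ := by
    intro x y hx hy
    have hx0 := norm_nonneg x
    have hy0 := norm_nonneg y
    have hb := hbm x y (by linarith) (by linarith)
    have hmul := (H2 x y (by linarith) (by linarith)).1
    set w := m (x, y) with hw
    have hxy := norm_add_le x y
    have hCx : C * ‖x‖ ≤ 1 := (by gcongr : C * ‖x‖ ≤ C * δ).trans hδC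
    have hb' : C * ‖x‖ * ‖y‖ ≤ 1 * ‖y‖ := by gcongr
    have hwn : ‖w‖ < 3 * δ := by
      have := norm_add_le (w - (x + y)) (x + y)
      rw [sub_add_cancel] at this
      linarith
    obtain ⟨-, hfd', -⟩ := H2 w (x + y) (by linarith) (by linarith)
    have hdn : ‖d (w, x + y)‖ ≤ K * (C * ‖x‖ * ‖y‖) := by
      refine (hbd w (x + y) (by linarith) (by linarith)).trans ?_
      rw [norm_sub_rev]
      gcongr
    have hdδ : ‖d (w, x + y)‖ < δ₀ := by
      have : (K : ℝ) * (C * ‖x‖ * ‖y‖) ≤ K * (3 * δ) := by gcongr; linarith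
      nlinarith [K.2]
    have hfw : ‖f w‖ ≤ ‖(1 : A)‖ + 1 := by
      have h1 := norm_add_le (f w - 1) 1
      rw [sub_add_cancel] at h1
      have h2 := hL w (by nlinarith [K.2])
      have h3 : M * ‖w‖ ≤ M * (3 * δ) := by gcongr
      linarith
    have e : f (x + y) - 1 - (f x - 1 + (f y - 1)) =
        f w * (f (d (w, x + y)) - 1) + (f x - 1) * (f y - 1) := by
      rw [mul_sub, ← hfd', hmul]
      noncomm_ring
    rw [e]
    calc _ ≤ ‖f w‖ * ‖f (d (w, x + y)) - 1‖ + ‖f x - 1‖ * ‖f y - 1‖ :=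
          (norm_add_le _ _).trans (add_le_add (norm_mul_le _ _) (norm_mul_le _ _))
      _ ≤ (‖(1 : A)‖ + 1) * (M * (K * (C * ‖x‖ * ‖y‖))) + (M * ‖x‖) * (M * ‖y‖) := by
          gcongr
          · exact (hL _ hdδ).trans (by gcongr)
          · exact hL x (by linarith)
          · exact hL y (by linarith)
      _ = _ := by ring
  obtain ⟨T, hT⟩ := exists_hasFDerivAt_of_almost_additive (a := fun x => f x - 1) (M := M)
    (by positivity) hδ (fun x hx => hL x (hx.trans_le hδδ)) hadd
  exact ⟨T, by simpa using hT.add_const 1⟩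

/-- A continuous local homomorphism into a Banach algebra is smooth near the unit. -/
theorem contDiffAt_of_local_hom [CompleteSpace A] {f : E → A} {m d : E × E → E}
    (hm : ContDiffAt ℝ 2 m (0, 0)) (hm0 : ∀ᶠ x in 𝓝 0, m (x, 0) = x)
    (h0m : ∀ᶠ y in 𝓝 0, m (0, y) = y)
    (hfm : ∀ᶠ p in 𝓝 ((0 : E), (0 : E)), f (m p) = f p.1 * f p.2)
    {U : Set (E × E)} (hU : IsOpen U) (h0U : (0, 0) ∈ U)
    (hd : ContDiffOn ℝ ∞ d U) (hdd : ∀ᶠ x in 𝓝 0, d (x, x) = 0)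
    (hfd : ∀ᶠ p in 𝓝 ((0 : E), (0 : E)), f p.2 = f p.1 * f (d p))
    (hf0 : f 0 = 1) (hfc : ContinuousAt f 0) :
    ContDiffAt ℝ ∞ f 0 := by
  obtain ⟨T, hT⟩ := exists_hasFDerivAt_of_local_hom hm hm0 h0m hfm
    ((hd.contDiffAt (hU.mem_nhds h0U)).of_le (by simp)) hdd hfd hf0 hfc
  have hev : ∀ᶠ v in 𝓝 (0 : E), (v, v) ∈ U ∧ d (v, v) = 0 ∧
      ∀ᶠ p in 𝓝 (v, v), f p.2 = f p.1 * f (d p) := by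
    have hc : ContinuousAt (fun v : E => (v, v)) 0 := by fun_prop
    exact (hc.eventually (hU.mem_nhds h0U)).and (hdd.and (hc.eventually hfd.eventually_nhds))
  obtain ⟨V, hV, hVo, h0V⟩ := eventually_nhds_iff.1 hev
  let D : E → E →L[ℝ] E := fun v => (fderiv ℝ d (v, v)).comp (.inr ℝ E E)
  have hder : ∀ v ∈ V, HasFDerivAt f ((ContinuousLinearMap.mul ℝ A (f v)).comp (T.comp (D v))) v := by
    intro v hv
    obtain ⟨hvU, hdv, hfv⟩ := hV v hv
    have hd1 : HasFDerivAt (fun y => d (v, y)) (D v) v :=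
      (((hd.contDiffAt (hU.mem_nhds hvU)).differentiableAt (by simp)).hasFDerivAt).comp v
        (hasFDerivAt_prodMk_right v v)
    have hT' : HasFDerivAt f T (d (v, v)) := by rwa [hdv]
    have h1 := ((ContinuousLinearMap.mul ℝ A (f v)).hasFDerivAt).comp v (hT'.comp v hd1)
    refine h1.congr_of_eventuallyEq ?_
    have hc : ContinuousAt (fun y : E => (v, y)) v := by fun_prop
    filter_upwards [hc.eventually hfv] with y hy
    exact hy
  have hDs : ContDiffOn ℝ ∞ D V := by
    have h1 : ContDiffOn ℝ ∞ (fderiv ℝ d) U := hd.fderiv_of_isOpen hU (by simp)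
    have h2 : ContDiffOn ℝ ∞ (fun v : E => fderiv ℝ d (v, v)) V :=
      h1.comp (contDiff_id.prodMk contDiff_id).contDiffOn (fun v hv => (hV v hv).1)
    exact h2.clm_comp contDiffOn_const
  have hn : ∀ n : ℕ, ContDiffOn ℝ n f V := by
    intro n
    induction n with
    | zero =>
      exact contDiffOn_zero.2 fun v hv => (hder v hv).continuousAt.continuousWithinAt
    | succ n ih =>
      push_cast
      rw [contDiffOn_succ_iff_fderiv_of_isOpen hVo]
      refine ⟨fun v hv => (hder v hv).differentiableAt.differentiableWithinAt, by simp, ?_⟩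
      refine ContDiffOn.congr (f := fun v =>
        (ContinuousLinearMap.mul ℝ A (f v)).comp (T.comp (D v))) ?_ fun v hv => (hder v hv).fderiv
      exact ((ContinuousLinearMap.mul ℝ A).contDiff.comp_contDiffOn ih).clm_comp
        (contDiffOn_const.clm_comp (hDs.of_le (by exact_mod_cast le_top)))
  exact (contDiffOn_infty.2 hn).contDiffAt (hVo.mem_nhds h0V)

end LocalHom

section GroupChart

open Topology

variable {E G : Type*} [NormedAddCommGroup E] [NormedSpace ℝ E]
  [TopologicalSpace G] [ChartedSpace E G] [Group G] [LieGroup 𝓘(ℝ, E) ∞ G]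

/-- A smooth binary operation fixing `1`, read in a chart at `1` that is recentred at `0`. -/
theorem exists_contDiffOn_operation (op : G × G → G)
    (hop : ContMDiff (𝓘(ℝ, E).prod 𝓘(ℝ, E)) 𝓘(ℝ, E) ∞ op) (h1 : op (1, 1) = 1) :
    ∃ U : Set (E × E), IsOpen U ∧ (0, 0) ∈ U ∧
      ContDiffOn ℝ ∞ (fun p : E × E => chartAt E (1 : G) (op
        ((chartAt E (1 : G)).symm (chartAt E (1 : G) 1 + p.1),
          (chartAt E (1 : G)).symm (chartAt E (1 : G) 1 + p.2))) - chartAt E (1 : G) 1) U ∧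
      ∀ p ∈ U, op ((chartAt E (1 : G)).symm (chartAt E (1 : G) 1 + p.1),
          (chartAt E (1 : G)).symm (chartAt E (1 : G) 1 + p.2)) ∈ (chartAt E (1 : G)).source := by
  set c := chartAt E (1 : G) with hc
  have hat : c ∈ IsManifold.maximalAtlas 𝓘(ℝ, E) ∞ G := IsManifold.chart_mem_maximalAtlas 1
  have hcs := contMDiffOn_of_mem_maximalAtlas hat
  have hct := contMDiffOn_symm_of_mem_maximalAtlas hat
  have hs : (1 : G) ∈ c.source := mem_chart_source E 1
  let a : E × E → E × E := fun p => (c 1 + p.1, c 1 + p.2)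
  have ha : ContDiff ℝ ∞ a :=
    (contDiff_const.add contDiff_fst).prodMk (contDiff_const.add contDiff_snd)
  let N : Set (E × E) := a ⁻¹' (c.target ×ˢ c.target)
  have hN : IsOpen N := (c.open_target.prod c.open_target).preimage ha.continuous
  let τ : E × E → G := fun p => op (c.symm (c 1 + p.1), c.symm (c 1 + p.2))
  have hτ : ContMDiffOn 𝓘(ℝ, E × E) 𝓘(ℝ, E) ∞ τ N := by
    refine hop.comp_contMDiffOn (ContMDiffOn.prodMk ?_ ?_)
    · exact hct.comp (contDiff_const.add contDiff_fst).contMDiff.contMDiffOn fun p hp => hp.1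
    · exact hct.comp (contDiff_const.add contDiff_snd).contMDiff.contMDiffOn fun p hp => hp.2
  refine ⟨N ∩ τ ⁻¹' c.source, hτ.continuousOn.isOpen_inter_preimage hN c.open_source, ⟨?_, ?_⟩, ?_,
    fun p hp => hp.2⟩
  · simp [N, a, c.map_source hs]
  · simp [τ, c.left_inv hs, h1, hs]
  · refine ContDiffOn.sub ?_ contDiffOn_const
    rw [← contMDiffOn_iff_contDiffOn]
    exact hcs.comp (hτ.mono inter_subset_left) fun p hp => hp.2

/-- A continuous homomorphism from a Banach-Lie group to the units of a Banach algebra is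
smooth. -/
theorem contMDiff_of_continuous_of_map_mul {A : Type*} [NormedRing A] [NormedAlgebra ℝ A]
    [CompleteSpace A] {F : G → A} (hF : Continuous F) (h1 : F 1 = 1)
    (hmul : ∀ g h, F (g * h) = F g * F h) : ContMDiff 𝓘(ℝ, E) 𝓘(ℝ, A) ∞ F := by
  set c := chartAt E (1 : G) with hc
  have hat : c ∈ IsManifold.maximalAtlas 𝓘(ℝ, E) ∞ G := IsManifold.chart_mem_maximalAtlas 1
  have hcs := contMDiffOn_of_mem_maximalAtlas hat
  have hs : (1 : G) ∈ c.source := mem_chart_source E 1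
  have htar : ∀ᶠ x in 𝓝 (0 : E), c 1 + x ∈ c.target := by
    have : ContinuousAt (fun x : E => c 1 + x) 0 := by fun_prop
    exact this.eventually (c.open_target.mem_nhds (by simpa using c.map_source hs))
  let f : E → A := fun x => F (c.symm (c 1 + x))
  have hf0 : f 0 = 1 := by simp [f, c.left_inv hs, h1]
  have hfc : ContinuousAt f 0 := by
    refine hF.continuousAt.comp ?_
    refine ContinuousAt.comp (g := c.symm) (f := fun x => c 1 + x) ?_ (by fun_prop)
    exact c.continuousAt_symm (by simpa using c.map_source hs)
  have hback : ∀ g ∈ c.source, f (c g - c 1) = F g := by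
    intro g hg
    simp [f, c.left_inv hg]
  obtain ⟨U, hU, h0U, hm, hUs⟩ := exists_contDiffOn_operation (fun p : G × G => p.1 * p.2)
    (contMDiff_mul 𝓘(ℝ, E) ∞) (by simp)
  obtain ⟨V, hV, h0V, hd, hVs⟩ := exists_contDiffOn_operation (fun p : G × G => p.1⁻¹ * p.2)
    ((contMDiff_fst (I := 𝓘(ℝ, E)) (J := 𝓘(ℝ, E))).inv.mul contMDiff_snd) (by simp)
  have hf : ContDiffAt ℝ ∞ f 0 := by
    refine contDiffAt_of_local_hom ((hm.contDiffAt (hU.mem_nhds h0U)).of_le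
      (WithTop.coe_le_coe.2 (le_top (a := (2 : ℕ∞))))) ?_ ?_ ?_ hV h0V hd ?_ ?_ hf0 hfc
    · filter_upwards [htar] with x hx
      simp [← hc, c.left_inv hs, c.right_inv hx]
    · filter_upwards [htar] with x hx
      simp [← hc, c.left_inv hs, c.right_inv hx]
    · filter_upwards [hU.mem_nhds h0U] with p hp
      rw [hback _ (hUs p hp), hmul]
    · filter_upwards [htar] with x hx
      simp [← hc]
    · filter_upwards [hV.mem_nhds h0V] with p hp
      rw [hback _ (hVs p hp), ← hmul, mul_inv_cancel_left]
  have hF1 : ContMDiffAt 𝓘(ℝ, E) 𝓘(ℝ, A) ∞ F 1 := by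
    have h2 : ContMDiffAt 𝓘(ℝ, E) 𝓘(ℝ, E) ∞ (fun g => c g - c 1) 1 :=
      (hcs.contMDiffAt (c.open_source.mem_nhds hs)).sub contMDiffAt_const
    have h3 : ContMDiffAt 𝓘(ℝ, E) 𝓘(ℝ, A) ∞ (fun g => f (c g - c 1)) 1 :=
      ContMDiffAt.comp 1 (g := f) (by rw [sub_self]; exact hf.contMDiffAt) h2
    refine h3.congr_of_eventuallyEq ?_
    filter_upwards [c.open_source.mem_nhds hs] with g hg using (hback g hg).symm
  intro u
  have h4 : ContMDiffAt 𝓘(ℝ, E) 𝓘(ℝ, A) ∞ (fun g => F (u⁻¹ * g)) u :=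
    ContMDiffAt.comp u (by rwa [inv_mul_cancel]) contMDiff_mul_left.contMDiffAt
  have h5 : ContMDiffAt 𝓘(ℝ, E) 𝓘(ℝ, A) ∞ (fun g => F u * F (u⁻¹ * g)) u :=
    ((ContinuousLinearMap.mul ℝ A (F u)).contDiff.contMDiff.contMDiffAt).comp u h4
  refine h5.congr_of_eventuallyEq (Filter.Eventually.of_forall fun g => ?_)
  change F g = F u * F (u⁻¹ * g)
  rw [← hmul, mul_inv_cancel_left]

end GroupChart

namespace HomogRep

variable {E G K : Type*} [NormedAddCommGroup E] [NormedSpace ℝ E] [CompleteSpace E]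
  [TopologicalSpace G] [ChartedSpace E G] [Group G] [LieGroup 𝓘(ℝ, E) ∞ G]
  {H : BanachLieSubgroup E G}
  [NormedAddCommGroup K] [InnerProductSpace ℂ K] [CompleteSpace K] (ρ : HomogRep H K)

omit [CompleteSpace E] in
theorem contMDiff_act : ContMDiff 𝓘(ℝ, E) 𝓘(ℝ, K →L[ℂ] K) ∞ ρ.act :=
  contMDiff_of_continuous_of_map_mul ρ.continuous_rep ρ.act_one ρ.act_mul

/-- The evaluation of operators on vectors, as a continuous bilinear map over `ℝ`. -/
noncomputable def applyL (K L : Type*) [NormedAddCommGroup K] [NormedSpace ℂ K]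
    [NormedAddCommGroup L] [NormedSpace ℂ L] : (K →L[ℂ] L) →L[ℝ] K →L[ℝ] L :=
  ContinuousLinearMap.restrictScalarsL ℂ K L ℝ ℝ

omit [CompleteSpace E] in
theorem contMDiff_act_apply :
    ContMDiff (𝓘(ℝ, E).prod 𝓘(ℝ, K)) 𝓘(ℝ, K) ∞ (fun p : G × K => ρ.act p.1 p.2) := by
  have h : ContMDiff (𝓘(ℝ, E).prod 𝓘(ℝ, K)) 𝓘(ℝ, K →L[ℝ] K) ∞
      (fun p : G × K => applyL K K (ρ.act p.1)) :=
    (applyL K K).contDiff.contMDiff.comp (ρ.contMDiff_act.comp contMDiff_fst)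
  exact h.clm_apply contMDiff_snd

/-- The orthogonal projection onto `sub` as a real linear map. -/
noncomputable def PR : K →L[ℝ] ρ.sub := ρ.P.restrictScalars ℝ

/-- The inclusion of `sub` as a real linear map. -/
noncomputable def subR : ρ.sub →L[ℝ] K := ρ.sub.subtypeL.restrictScalars ℝ

omit [CompleteSpace E] in
theorem contMDiff_act_sub :
    ContMDiff (𝓘(ℝ, E).prod 𝓘(ℝ, ρ.sub)) 𝓘(ℝ, K) ∞ (fun p : G × ρ.sub => ρ.act p.1 p.2) :=
  ρ.contMDiff_act_apply.comp
    (contMDiff_fst.prodMk (ρ.subR.contDiff.contMDiff.comp contMDiff_snd))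

omit [CompleteSpace E] in
/-- The coordinate expression of the quotient map in a bundle chart is smooth. -/
theorem contMDiffOn_bundleChart_cls {e : OpenPartialHomeomorph (G ⧸ H.toSubgroup) H.Model}
    {s : H.Model → G} (hs : H.IsSmoothSection e s) :
    ContMDiffOn (𝓘(ℝ, E).prod 𝓘(ℝ, ρ.sub)) 𝓘(ℝ, H.Model × ρ.sub) ∞
      (fun p : G × ρ.sub => ρ.bundleChart e s hs (ρ.cls p.1 p.2))
      {p | QuotientGroup.mk p.1 ∈ e.source} := by
  have h1 : ContMDiffOn (𝓘(ℝ, E).prod 𝓘(ℝ, ρ.sub)) 𝓘(ℝ, H.Model) ∞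
      (fun p : G × ρ.sub => e (QuotientGroup.mk p.1)) {p | QuotientGroup.mk p.1 ∈ e.source} :=
    hs.1.comp contMDiff_fst.contMDiffOn (fun p hp => hp)
  have h2 := (hs.2.1.comp h1 (fun p hp => e.map_source hp)).inv
  have h3 : ContMDiffOn (𝓘(ℝ, E).prod 𝓘(ℝ, ρ.sub)) 𝓘(ℝ, ρ.sub) ∞
      (fun p : G × ρ.sub => ρ.coord (s (e (QuotientGroup.mk p.1))) (ρ.cls p.1 p.2))
      {p | QuotientGroup.mk p.1 ∈ e.source} :=
    ρ.PR.contDiff.contMDiff.comp_contMDiffOn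
      (ρ.contMDiff_act_apply.comp_contMDiffOn (h2.prodMk ρ.contMDiff_act_sub.contMDiffOn))
  exact h1.prodMk_space h3

omit [CompleteSpace E] [LieGroup 𝓘(ℝ, E) ∞ G] in
theorem contMDiffOn_section {e : OpenPartialHomeomorph (G ⧸ H.toSubgroup) H.Model}
    {s : H.Model → G} (hs : H.IsSmoothSection e s) :
    ContMDiffOn 𝓘(ℝ, H.Model × ρ.sub) (𝓘(ℝ, E).prod 𝓘(ℝ, ρ.sub)) ∞
      (fun p : H.Model × ρ.sub => (s p.1, p.2)) (e.target ×ˢ univ) :=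
  (hs.2.1.comp contDiff_fst.contMDiff.contMDiffOn fun _ hp => hp.1).prodMk
    contDiff_snd.contMDiff.contMDiffOn

instance isManifold : IsManifold 𝓘(ℝ, H.Model × ρ.sub) ∞ ρ.Total := by
  refine isManifold_of_contDiffOn _ _ _ ?_
  rintro _ _ ⟨e, s, hs, rfl⟩ ⟨e', s', hs', rfl⟩
  simp only [modelWithCornersSelf_coe, modelWithCornersSelf_coe_symm, Function.comp_id,
    Function.id_comp, preimage_id, range_id, inter_univ]
  rw [← contMDiffOn_iff_contDiffOn]
  exact (ρ.contMDiffOn_bundleChart_cls hs').comp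
    ((ρ.contMDiffOn_section hs).mono fun x hx => hx.1) fun x hx => hx.2

/-- The quotient map `G × sub → G ×_H sub` is smooth. -/
theorem contMDiff_cls :
    ContMDiff (𝓘(ℝ, E).prod 𝓘(ℝ, ρ.sub)) 𝓘(ℝ, H.Model × ρ.sub) ∞
      (fun p : G × ρ.sub => ρ.cls p.1 p.2) := by
  intro p
  obtain ⟨e, hz, s, hs⟩ := H.exists_chart (QuotientGroup.mk p.1)
  have hat : ρ.bundleChart e s hs ∈ IsManifold.maximalAtlas 𝓘(ℝ, H.Model × ρ.sub) ∞ ρ.Total :=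
    IsManifold.subset_maximalAtlas ⟨e, s, hs, rfl⟩
  have hsm := contMDiffOn_symm_of_mem_maximalAtlas hat
  have hop : IsOpen {p : G × ρ.sub | (QuotientGroup.mk p.1 : G ⧸ H.toSubgroup) ∈ e.source} :=
    e.open_source.preimage (QuotientGroup.continuous_mk.comp continuous_fst)
  have h := hsm.comp (ρ.contMDiffOn_bundleChart_cls hs)
    (fun q hq => (ρ.bundleChart e s hs).map_source hq)
  refine (h.contMDiffAt (hop.mem_nhds hz)).congr_of_eventuallyEq ?_
  filter_upwards [hop.mem_nhds hz] with q hq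
  exact ((ρ.bundleChart e s hs).left_inv hq).symm

/-- A map on `G ×_H sub` is smooth if its lift to `G × sub` is smooth. -/
theorem contMDiff_of_comp_cls {F N : Type*} [NormedAddCommGroup F] [NormedSpace ℝ F]
    [TopologicalSpace N] [ChartedSpace F N] {f : ρ.Total → N}
    (hf : ContMDiff (𝓘(ℝ, E).prod 𝓘(ℝ, ρ.sub)) 𝓘(ℝ, F) ∞
      (fun p : G × ρ.sub => f (ρ.cls p.1 p.2))) :
    ContMDiff 𝓘(ℝ, H.Model × ρ.sub) 𝓘(ℝ, F) ∞ f := by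
  intro x
  obtain ⟨e, hz, s, hs⟩ := H.exists_chart (ρ.proj x)
  have hat : ρ.bundleChart e s hs ∈ IsManifold.maximalAtlas 𝓘(ℝ, H.Model × ρ.sub) ∞ ρ.Total :=
    IsManifold.subset_maximalAtlas ⟨e, s, hs, rfl⟩
  have hx : (ρ.bundleChart e s hs).source ∈ nhds x :=
    (ρ.bundleChart e s hs).open_source.mem_nhds hz
  have h := (hf.comp_contMDiffOn (ρ.contMDiffOn_section hs)).comp
    (contMDiffOn_of_mem_maximalAtlas hat) (fun q hq => (ρ.bundleChart e s hs).map_source hq)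
  refine (h.contMDiffAt hx).congr_of_eventuallyEq ?_
  filter_upwards [hx] with q hq
  exact congrArg f ((ρ.bundleChart e s hs).left_inv hq).symm

theorem contMDiff_ev : ContMDiff 𝓘(ℝ, H.Model × ρ.sub) 𝓘(ℝ, K) ∞ ρ.ev :=
  ρ.contMDiff_of_comp_cls ρ.contMDiff_act_sub

end HomogRep

namespace BanachLieSubgroup

variable {E G : Type*} [NormedAddCommGroup E] [NormedSpace ℝ E] [CompleteSpace E]
  [TopologicalSpace G] [ChartedSpace E G] [Group G] [LieGroup 𝓘(ℝ, E) ∞ G]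
  (H : BanachLieSubgroup E G)

/-- The projection `G → G ⧸ H` is smooth. -/
theorem contMDiff_mk :
    ContMDiff 𝓘(ℝ, E) 𝓘(ℝ, H.Model) ∞ (QuotientGroup.mk : G → G ⧸ H.toSubgroup) := by
  intro g
  obtain ⟨e, hz, s, hs⟩ := H.exists_chart (QuotientGroup.mk g)
  have hat : e ∈ IsManifold.maximalAtlas 𝓘(ℝ, H.Model) ∞ (G ⧸ H.toSubgroup) :=
    IsManifold.subset_maximalAtlas ⟨s, hs⟩
  have hop : IsOpen {g : G | (QuotientGroup.mk g : G ⧸ H.toSubgroup) ∈ e.source} :=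
    e.open_source.preimage QuotientGroup.continuous_mk
  have h := (contMDiffOn_symm_of_mem_maximalAtlas hat).comp hs.1 (fun q hq => e.map_source hq)
  refine (h.contMDiffAt (hop.mem_nhds hz)).congr_of_eventuallyEq ?_
  filter_upwards [hop.mem_nhds hz] with q hq
  exact (e.left_inv hq).symm

/-- Through every point of `G ⧸ H` passes a smooth local section of the projection. -/
theorem exists_localSection (z : G ⧸ H.toSubgroup) :
    ∃ t : G ⧸ H.toSubgroup → G, ContMDiffAt 𝓘(ℝ, H.Model) 𝓘(ℝ, E) ∞ t z ∧
      ∀ᶠ y in nhds z, QuotientGroup.mk (t y) = y := by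
  obtain ⟨e, hz, s, hs⟩ := H.exists_chart z
  have hat : e ∈ IsManifold.maximalAtlas 𝓘(ℝ, H.Model) ∞ (G ⧸ H.toSubgroup) :=
    IsManifold.subset_maximalAtlas ⟨s, hs⟩
  have hn := e.open_source.mem_nhds hz
  refine ⟨fun y => s (e y), ?_, ?_⟩
  · exact (hs.2.1.comp (contMDiffOn_of_mem_maximalAtlas hat)
      (fun q hq => e.map_source hq)).contMDiffAt hn
  · filter_upwards [hn] with y hy
    rw [hs.2.2 _ (e.map_source hy), e.left_inv hy]

end BanachLieSubgroup

theorem HomogRep.contMDiff_homogSection {E G K : Type*} [NormedAddCommGroup E] [NormedSpace ℝ E]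
    [CompleteSpace E] [TopologicalSpace G] [ChartedSpace E G] [Group G] [LieGroup 𝓘(ℝ, E) ∞ G]
    {H : BanachLieSubgroup E G} [NormedAddCommGroup K] [InnerProductSpace ℂ K] [CompleteSpace K]
    (ρ : HomogRep H K) {φ : G → ρ.sub} (hφ : ContMDiff 𝓘(ℝ, E) 𝓘(ℝ, ρ.sub) ∞ φ)
    (hφ_equiv : ∀ u : G, ∀ w ∈ H.toSubgroup, (φ (u * w) : K) = ρ.act w⁻¹ (φ u)) :
    ContMDiff 𝓘(ℝ, H.Model) 𝓘(ℝ, H.Model × ρ.sub) ∞ (ρ.homogSection φ hφ_equiv) := by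
  intro z
  obtain ⟨t, ht, htz⟩ := H.exists_localSection z
  have h : ContMDiffAt 𝓘(ℝ, H.Model) 𝓘(ℝ, H.Model × ρ.sub) ∞
      (fun y => ρ.cls (t y) (φ (t y))) z :=
    ContMDiffAt.comp z (g := fun p : G × ρ.sub => ρ.cls p.1 p.2) ρ.contMDiff_cls.contMDiffAt
      (ht.prodMk (hφ.contMDiffAt.comp z ht))
  refine h.congr_of_eventuallyEq ?_
  filter_upwards [htz] with y hy
  conv_lhs => rw [← hy]
  rfl

section LeftTranslation

variable {E G : Type*} [NormedAddCommGroup E] [NormedSpace ℝ E]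
  [TopologicalSpace G] [ChartedSpace E G] [Group G] [LieGroup 𝓘(ℝ, E) ∞ G]

theorem TangentBundle.mk_eq_mk {E H M : Type*} [NormedAddCommGroup E] [NormedSpace ℝ E]
    [TopologicalSpace H] {I : ModelWithCorners ℝ E H} [TopologicalSpace M] [ChartedSpace H M]
    {x y : M} {v w : E} (h : x = y) (hv : v = w) :
    (⟨x, v⟩ : TangentBundle I M) = ⟨y, w⟩ := by
  subst h hv
  rfl

omit [LieGroup 𝓘(ℝ, E) ∞ G] in
/-- The left translate of a vector at `1` as a value of the tangent map of the translation. -/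
theorem tangentMap_mul_left_one (g : G) (X : GroupLieAlgebra 𝓘(ℝ, E) G) :
    tangentMap 𝓘(ℝ, E) 𝓘(ℝ, E) (g * ·) ⟨1, X⟩ = ⟨g, mulInvariantVectorField X g⟩ :=
  TangentBundle.mk_eq_mk (mul_one g) rfl

theorem mdifferentiable_mul_left_infty (g : G) :
    MDifferentiable 𝓘(ℝ, E) 𝓘(ℝ, E) (g * · : G → G) :=
  (contMDiff_mul_left (I := 𝓘(ℝ, E)) (n := ∞)).mdifferentiable (by simp)

/-- Every tangent vector of a Lie group is the left translate of a vector at `1`. -/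
theorem exists_mulInvariantVectorField_eq (v : TangentBundle 𝓘(ℝ, E) G) :
    ∃ X : GroupLieAlgebra 𝓘(ℝ, E) G, v = ⟨v.1, mulInvariantVectorField X v.1⟩ := by
  obtain ⟨X, hX⟩ : ∃ X : GroupLieAlgebra 𝓘(ℝ, E) G,
      tangentMap 𝓘(ℝ, E) 𝓘(ℝ, E) (v.1⁻¹ * ·) v = ⟨1, X⟩ :=
    ⟨_, TangentBundle.mk_eq_mk (inv_mul_cancel v.1) rfl⟩
  refine ⟨X, ?_⟩
  rw [← tangentMap_mul_left_one, ← hX]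
  have h := congrFun (tangentMap_comp (mdifferentiable_mul_left_infty (E := E) v.1)
    (mdifferentiable_mul_left_infty (E := E) v.1⁻¹)) v
  have e2 : ((v.1 * ·) ∘ (v.1⁻¹ * ·) : G → G) = id := by
    funext x
    simp
  rw [e2, tangentMap_id] at h
  exact h

end LeftTranslation

namespace BanachLieSubgroup

variable {E G : Type*} [NormedAddCommGroup E] [NormedSpace ℝ E] [CompleteSpace E]
  [TopologicalSpace G] [ChartedSpace E G] [Group G] [LieGroup 𝓘(ℝ, E) ∞ G]
  (H : BanachLieSubgroup E G)

theorem mdifferentiable_mk :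
    MDifferentiable 𝓘(ℝ, E) 𝓘(ℝ, H.Model) (QuotientGroup.mk : G → G ⧸ H.toSubgroup) :=
  H.contMDiff_mk.mdifferentiable (by simp)

/-- The Lie algebra of the subgroup is in the kernel of the tangent map of the projection. -/
theorem mfderiv_mk_lieAlgebra (u : G) {X : GroupLieAlgebra 𝓘(ℝ, E) G} (hX : X ∈ H.lieAlgebra) :
    mfderiv 𝓘(ℝ, E) 𝓘(ℝ, H.Model) (QuotientGroup.mk : G → G ⧸ H.toSubgroup) u
      (mulInvariantVectorField X u) = 0 := by
  obtain ⟨c, hc, hcH, hc0, rfl⟩ := hX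
  have hcd : MDifferentiable 𝓘(ℝ, ℝ) 𝓘(ℝ, E) c := hc.mdifferentiable (by simp)
  have e0 : tangentMap 𝓘(ℝ, ℝ) 𝓘(ℝ, E) c ⟨0, (1 : ℝ)⟩ =
      ⟨1, mfderiv 𝓘(ℝ, ℝ) 𝓘(ℝ, E) c 0 (1 : ℝ)⟩ := TangentBundle.mk_eq_mk hc0 rfl
  have h1 := congrFun (tangentMap_comp (mdifferentiable_mul_left_infty (E := E) u) hcd)
    ⟨0, (1 : ℝ)⟩
  have h2 := congrFun (tangentMap_comp H.mdifferentiable_mk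
    ((mdifferentiable_mul_left_infty (E := E) u).comp hcd)) ⟨0, (1 : ℝ)⟩
  rw [comp_apply] at h1 h2
  rw [h1, e0] at h2
  erw [tangentMap_mul_left_one] at h2
  have e3 : (QuotientGroup.mk : G → G ⧸ H.toSubgroup) ∘ (u * ·) ∘ c =
      fun _ => QuotientGroup.mk u := by
    funext t
    exact QuotientGroup.mk_mul_of_mem _ (hcH t)
  rw [e3] at h2
  have h3 := congrArg (fun v : TangentBundle 𝓘(ℝ, H.Model) (G ⧸ H.toSubgroup) => (v.2 : H.Model)) h2
  refine h3.symm.trans ?_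
  simp only [tangentMap, mfderiv_const]
  rfl

theorem exists_baseTangent_eq {m : Submodule ℝ (GroupLieAlgebra 𝓘(ℝ, E) G)}
    (hm : IsCompl H.lieAlgebra m) (v : TangentBundle 𝓘(ℝ, H.Model) (G ⧸ H.toSubgroup)) :
    ∃ u : G, ∃ X ∈ m, v = H.baseTangent u X := by
  obtain ⟨t, ht, htz⟩ := H.exists_localSection v.1
  have h1 := tangentMap_comp_at v (H.mdifferentiable_mk (t v.1)) (ht.mdifferentiableAt (by simp))
  have h2 : tangentMap 𝓘(ℝ, H.Model) 𝓘(ℝ, H.Model)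
      ((QuotientGroup.mk : G → G ⧸ H.toSubgroup) ∘ t) v = v := by
    have e : (QuotientGroup.mk : G → G ⧸ H.toSubgroup) ∘ t =ᶠ[nhds v.1] id := htz
    refine TangentBundle.mk_eq_mk htz.self_of_nhds ?_
    rw [e.mfderiv_eq, mfderiv_id]
    rfl
  obtain ⟨X, hX⟩ := exists_mulInvariantVectorField_eq (tangentMap 𝓘(ℝ, H.Model) 𝓘(ℝ, E) t v)
  have hX' : X ∈ H.lieAlgebra ⊔ m := by rw [hm.sup_eq_top]; trivial
  obtain ⟨Y, hY, Z, hZ, rfl⟩ := Submodule.mem_sup.1 hX'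
  refine ⟨t v.1, Z, hZ, ?_⟩
  rw [h2, hX] at h1
  refine h1.trans (TangentBundle.mk_eq_mk rfl ?_)
  rw [mulInvariantVectorField_add]
  refine (map_add (mfderiv 𝓘(ℝ, E) 𝓘(ℝ, H.Model) (QuotientGroup.mk : G → G ⧸ H.toSubgroup)
    (tangentMap 𝓘(ℝ, H.Model) 𝓘(ℝ, E) t v).1) _ _).trans ?_
  rw [H.mfderiv_mk_lieAlgebra _ hY]
  exact zero_add _

end BanachLieSubgroup

namespace HomogRep

variable {E G K : Type*} [NormedAddCommGroup E] [NormedSpace ℝ E]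
  [TopologicalSpace G] [ChartedSpace E G] [Group G]
  {H : BanachLieSubgroup E G}
  [NormedAddCommGroup K] [InnerProductSpace ℂ K] [CompleteSpace K] (ρ : HomogRep H K)

theorem P_coe (f : ρ.sub) : ρ.P (f : K) = f := by simp [P]

/-- The projection onto an `H`-invariant subspace commutes with the action of `H`. -/
theorem P_act {w : G} (hw : w ∈ H.toSubgroup) (y : K) :
    (ρ.P (ρ.act w⁻¹ y) : K) = ρ.act w⁻¹ (ρ.P y) := by
  refine (Submodule.eq_starProjection_of_mem_of_inner_eq_zero
    (ρ.rep_mem _ (H.inv_mem hw) _ (ρ.P y).2) fun s hs => ?_)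
  have e : ρ.act w⁻¹ = ContinuousLinearMap.adjoint (ρ.act w) := by
    rw [act, map_inv]
    rfl
  change inner ℂ (ρ.act w⁻¹ y - ρ.act w⁻¹ (ρ.P y)) s = 0
  rw [← map_sub, e, ContinuousLinearMap.adjoint_inner_left]
  exact ρ.sub.starProjection_inner_eq_zero y _ (ρ.rep_mem _ hw s hs)

theorem coord_cls_coe {g a : G} (h : g⁻¹ * a ∈ H.toSubgroup) (f : ρ.sub) :
    (ρ.coord a (ρ.cls g f) : K) = ρ.act (g⁻¹ * a)⁻¹ f := by
  have e : ρ.act a⁻¹ (ρ.act g f) = ρ.act (g⁻¹ * a)⁻¹ f := by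
    rw [← act_mul_apply]
    simp
  rw [coord, ev_cls, e, ρ.P_act h, P_coe]

theorem line_cls (g : G) (f k : ρ.sub) (t : ℝ) :
    ρ.line (ρ.cls g f) (ρ.cls g k) t = ρ.cls g (f + t • k) := by
  rw [line, proj_cls]
  set a : G := (QuotientGroup.mk g : G ⧸ H.toSubgroup).out with ha
  have hw : g⁻¹ * a ∈ H.toSubgroup := QuotientGroup.eq.1 (Quotient.out_eq _).symm
  have h := ρ.cls_mul g hw (f + t • k)
    (ρ.coord a (ρ.cls g f) + t • ρ.coord a (ρ.cls g k)) (by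
      have e : ∀ x : K, ρ.act (g⁻¹ * a)⁻¹ (t • x) = t • ρ.act (g⁻¹ * a)⁻¹ x := fun x =>
        ((ρ.act (g⁻¹ * a)⁻¹).restrictScalars ℝ).map_smul t x
      change (ρ.coord a (ρ.cls g f) : K) + t • (ρ.coord a (ρ.cls g k) : K) =
        ρ.act (g⁻¹ * a)⁻¹ ((f : K) + t • (k : K))
      rw [coord_cls_coe _ hw, coord_cls_coe _ hw, map_add, e])
  rwa [mul_inv_cancel_left] at h

theorem eq_of_proj_eq_of_ev_eq {x y : ρ.Total} (h : ρ.proj x = ρ.proj y) (he : ρ.ev x = ρ.ev y) :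
    x = y := by
  obtain ⟨a, ha⟩ := QuotientGroup.mk_surjective (ρ.proj x)
  rw [← ρ.cls_coord a x ha.symm, ← ρ.cls_coord a y (h.symm.trans ha.symm), coord, coord, he]

theorem cls_P_eq_of_act_eq {g g' : G} {y y' : K}
    (h : (QuotientGroup.mk g : G ⧸ H.toSubgroup) = QuotientGroup.mk g')
    (he : ρ.act g y = ρ.act g' y') : ρ.cls g (ρ.P y) = ρ.cls g' (ρ.P y') := by
  have hw : g⁻¹ * g' ∈ H.toSubgroup := QuotientGroup.eq.1 h
  have hy : y' = ρ.act (g⁻¹ * g')⁻¹ y := by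
    rw [mul_inv_rev, inv_inv, act_mul_apply, he, act_inv_act]
  have := ρ.cls_mul g hw (ρ.P y) (ρ.P y') (by rw [hy, ρ.P_act hw])
  rw [mul_inv_cancel_left] at this
  exact this.symm

variable [CompleteSpace E] [LieGroup 𝓘(ℝ, E) ∞ G]

theorem mdifferentiable_cls :
    MDifferentiable (𝓘(ℝ, E).prod 𝓘(ℝ, ρ.sub)) 𝓘(ℝ, H.Model × ρ.sub)
      (fun p : G × ρ.sub => ρ.cls p.1 p.2) := ρ.contMDiff_cls.mdifferentiable (by simp)

theorem mdifferentiable_ev : MDifferentiable 𝓘(ℝ, H.Model × ρ.sub) 𝓘(ℝ, K) ρ.ev :=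
  ρ.contMDiff_ev.mdifferentiable (by simp)

omit [CompleteSpace E] in
/-- The derivative of `g ↦ ρ(g) f` in the direction `gX` is `ρ(g) dρ(X) f`. -/
theorem mfderiv_act_apply (g : G) (X : GroupLieAlgebra 𝓘(ℝ, E) G) (f : K) :
    (mfderiv 𝓘(ℝ, E) 𝓘(ℝ, K) (fun z => ρ.act z f) g (mulInvariantVectorField X g) : K) =
      ρ.act g (ρ.deriv X f) := by
  have hact : MDifferentiable 𝓘(ℝ, E) 𝓘(ℝ, K →L[ℂ] K) ρ.act :=
    ρ.contMDiff_act.mdifferentiable (by simp)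
  let L : (K →L[ℂ] K) →L[ℝ] K := ((ρ.act g).restrictScalars ℝ).comp ((applyL K K).flip f)
  let L₁ : (K →L[ℂ] K) →L[ℝ] K := (applyL K K).flip f
  have hL₁ : MDifferentiable 𝓘(ℝ, E) 𝓘(ℝ, K) (fun z => ρ.act z f) :=
    MDifferentiable.comp (g := L₁) L₁.mdifferentiable hact
  have h1 := congrFun (tangentMap_comp hL₁ (mdifferentiable_mul_left_infty (E := E) g)) ⟨1, X⟩
  rw [comp_apply, tangentMap_mul_left_one] at h1
  have e : (fun z => ρ.act z f) ∘ (g * ·) = L ∘ ρ.act := by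
    funext z
    exact ρ.act_mul_apply g z f
  rw [e] at h1
  have h2 := congrArg (fun v : TangentBundle 𝓘(ℝ, K) K => (v.2 : K)) h1
  refine h2.symm.trans ?_
  simp only [tangentMap]
  rw [mfderiv_comp (1 : G) L.mdifferentiableAt (hact 1), ContinuousLinearMap.mfderiv_eq]
  rfl

/-- The tangent map of `[(g, f)] ↦ ρ(g) f`. -/
theorem tangentMap_ev_tangentClass (g : G) (X : GroupLieAlgebra 𝓘(ℝ, E) G) (f h : ρ.sub) :
    ((tangentMap 𝓘(ℝ, H.Model × ρ.sub) 𝓘(ℝ, K) ρ.ev (ρ.tangentClass g X f h)).2 : K) =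
      ρ.act g (ρ.deriv X f + h) := by
  have h1 := congrFun (tangentMap_comp ρ.mdifferentiable_ev ρ.mdifferentiable_cls)
    ⟨(g, f), (mulInvariantVectorField X g, h)⟩
  have h2 := congrArg (fun v : TangentBundle 𝓘(ℝ, K) K => (v.2 : K)) h1
  refine h2.symm.trans ?_
  have h3 : MDifferentiableAt (𝓘(ℝ, E).prod 𝓘(ℝ, ρ.sub)) 𝓘(ℝ, K)
      (fun p : G × ρ.sub => ρ.act p.1 p.2) (g, f) :=
    ρ.contMDiff_act_sub.mdifferentiable (by simp) _
  refine (mfderiv_prod_eq_add_apply h3).trans ?_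
  rw [map_add]
  refine congrArg₂ (fun x y : K => x + y) (ρ.mfderiv_act_apply g X f) ?_
  have h4 : mfderiv 𝓘(ℝ, ρ.sub) 𝓘(ℝ, K) (fun z : ρ.sub => ρ.act g z) f =
      ((ρ.act g).restrictScalars ℝ).comp ρ.subR :=
    (((ρ.act g).restrictScalars ℝ).comp ρ.subR).mfderiv_eq
  exact congrArg (fun A : ρ.sub →L[ℝ] K => A h) h4

theorem tangentClass_zero_eq_vert (g : G) (f k : ρ.sub) :
    ρ.tangentClass g 0 f k = ρ.vert ⟨(ρ.cls g f, ρ.cls g k), rfl⟩ := by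
  have e : ρ.line (ρ.cls g f) (ρ.cls g k) =
      (fun p : G × ρ.sub => ρ.cls p.1 p.2) ∘ fun t : ℝ => (g, f + t • k) :=
    funext fun t => ρ.line_cls g f k t
  have hd : HasFDerivAt (fun t : ℝ => f + t • k)
      ((ContinuousLinearMap.id ℝ ℝ).smulRight k) 0 :=
    ((ContinuousLinearMap.id ℝ ℝ).smulRight k).hasFDerivAt.const_add f
  have hc : MDifferentiableAt 𝓘(ℝ, ℝ) (𝓘(ℝ, E).prod 𝓘(ℝ, ρ.sub)) (fun t : ℝ => (g, f + t • k)) 0 :=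
    mdifferentiableAt_const.prodMk hd.hasMFDerivAt.mdifferentiableAt
  have h1 := tangentMap_comp_at (⟨0, (1 : ℝ)⟩ : TangentBundle 𝓘(ℝ, ℝ) ℝ)
    (ρ.mdifferentiable_cls _) hc
  rw [← e] at h1
  refine Eq.trans ?_ h1.symm
  refine congrArg (tangentMap (𝓘(ℝ, E).prod 𝓘(ℝ, ρ.sub)) 𝓘(ℝ, H.Model × ρ.sub)
    fun p : G × ρ.sub => ρ.cls p.1 p.2) ?_
  have h2 := mdifferentiableAt_const (I := 𝓘(ℝ, ℝ)) (I' := 𝓘(ℝ, E)) (c := g) (x := (0 : ℝ))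
    |>.mfderiv_prod hd.hasMFDerivAt.mdifferentiableAt
  have h3 : mfderiv 𝓘(ℝ, ℝ) (𝓘(ℝ, E).prod 𝓘(ℝ, ρ.sub)) (fun t : ℝ => (g, f + t • k)) 0 (1 : ℝ) =
      ((0 : E), k) := by
    rw [h2, mfderiv_const, hd.hasMFDerivAt.mfderiv]
    refine Prod.ext rfl ?_
    exact one_smul ℝ k
  have h4 : (mulInvariantVectorField (0 : GroupLieAlgebra 𝓘(ℝ, E) G) g : E) = 0 :=
    map_zero (mfderiv 𝓘(ℝ, E) 𝓘(ℝ, E) (g * ·) (1 : G))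
  have h5 : f = f + (0 : ℝ) • k := by simp
  refine TangentBundle.mk_eq_mk (E := E × ρ.sub) (I := 𝓘(ℝ, E).prod 𝓘(ℝ, ρ.sub)) (Prod.ext rfl h5) ?_
  exact (Prod.ext h4 rfl : ((mulInvariantVectorField (0 : GroupLieAlgebra 𝓘(ℝ, E) G) g : E), k) =
    ((0 : E), k)).trans h3.symm

omit [CompleteSpace E] [LieGroup 𝓘(ℝ, E) ∞ G] in
theorem deriv_zero : ρ.deriv (0 : GroupLieAlgebra 𝓘(ℝ, E) G) = 0 :=
  map_zero (mfderiv 𝓘(ℝ, E) 𝓘(ℝ, K →L[ℂ] K) ρ.act 1)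

theorem vert_fst_and_ev (p : ρ.FibProd) : (ρ.vert p).1 = p.1.1 ∧
    ((tangentMap 𝓘(ℝ, H.Model × ρ.sub) 𝓘(ℝ, K) ρ.ev (ρ.vert p)).2 : K) = ρ.ev p.1.2 := by
  obtain ⟨⟨x, y⟩, h⟩ := p
  obtain ⟨g, hg⟩ := QuotientGroup.mk_surjective (ρ.proj x)
  obtain ⟨f, rfl⟩ : ∃ f, ρ.cls g f = x := ⟨_, ρ.cls_coord g x hg.symm⟩
  obtain ⟨k, rfl⟩ : ∃ k, ρ.cls g k = y := ⟨_, ρ.cls_coord g y (h.symm.trans hg.symm)⟩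
  have e := ρ.tangentClass_zero_eq_vert g f k
  refine ⟨(congrArg (fun v : TangentBundle 𝓘(ℝ, H.Model × ρ.sub) ρ.Total => v.1) e).symm, ?_⟩
  rw [← e, tangentMap_ev_tangentClass, deriv_zero, _root_.zero_apply, zero_add]
  rfl

theorem vert_injective : Injective ρ.vert := by
  intro p q h
  obtain ⟨h1, h2⟩ := ρ.vert_fst_and_ev p
  obtain ⟨h3, h4⟩ := ρ.vert_fst_and_ev q
  rw [h] at h1 h2
  have e1 : p.1.1 = q.1.1 := h1.symm.trans h3
  have e2 : p.1.2 = q.1.2 := ρ.eq_of_proj_eq_of_ev_eq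
    (by rw [← p.2, ← q.2, e1]) (h2.symm.trans h4)
  exact Subtype.ext (Prod.ext e1 e2)

theorem vertProj_tangentClass_zero (g : G) (f k : ρ.sub) :
    ρ.vertProj (ρ.tangentClass g 0 f k) = ρ.cls g k := by
  rw [tangentClass_zero_eq_vert]
  exact congrArg (fun p : ρ.FibProd => p.1.2) (leftInverse_invFun ρ.vert_injective _)

/-- The natural connection is well defined. -/
theorem natConn_tangentClass (g : G) (X : GroupLieAlgebra 𝓘(ℝ, E) G) (f h : ρ.sub) :
    ρ.natConn (ρ.tangentClass g X f h) = ρ.tangentClass g 0 f (ρ.P (ρ.deriv X f) + h) := by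
  have hp := invFun_eq (f := fun p : (G × GroupLieAlgebra 𝓘(ℝ, E) G) × (ρ.sub × ρ.sub) =>
    ρ.tangentClass p.1.1 p.1.2 p.2.1 p.2.2) (b := ρ.tangentClass g X f h)
    ⟨((g, X), (f, h)), rfl⟩
  rw [natConn]
  generalize invFun (fun p : (G × GroupLieAlgebra 𝓘(ℝ, E) G) × (ρ.sub × ρ.sub) =>
    ρ.tangentClass p.1.1 p.1.2 p.2.1 p.2.2) (ρ.tangentClass g X f h) = p at hp ⊢
  obtain ⟨⟨g', X'⟩, f', h'⟩ := p
  have e1 : ρ.cls g' f' = ρ.cls g f :=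
    congrArg (fun v : TangentBundle 𝓘(ℝ, H.Model × ρ.sub) ρ.Total => v.1) hp
  have e2 := congrArg (fun v : TangentBundle 𝓘(ℝ, H.Model × ρ.sub) ρ.Total =>
    ((tangentMap 𝓘(ℝ, H.Model × ρ.sub) 𝓘(ℝ, K) ρ.ev v).2 : K)) hp
  simp only [tangentMap_ev_tangentClass] at e2
  have e3 := ρ.cls_P_eq_of_act_eq (congrArg ρ.proj e1) e2
  rw [map_add, map_add, P_coe, P_coe] at e3
  simp only [tangentClass_zero_eq_vert]
  exact congrArg ρ.vert (Subtype.ext (Prod.ext e1 e3))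

/-- The tangent map of a homogeneous section. -/
theorem tangentMap_homogSection {φ : G → ρ.sub} (hφ : ContMDiff 𝓘(ℝ, E) 𝓘(ℝ, ρ.sub) ∞ φ)
    (hφ_equiv : ∀ u : G, ∀ w ∈ H.toSubgroup, (φ (u * w) : K) = ρ.act w⁻¹ (φ u))
    (u : G) (X : GroupLieAlgebra 𝓘(ℝ, E) G) :
    tangentMap 𝓘(ℝ, H.Model) 𝓘(ℝ, H.Model × ρ.sub) (ρ.homogSection φ hφ_equiv)
      (H.baseTangent u X) = ρ.tangentClass u X (φ u) (ρ.leftDeriv φ u X) := by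
  have hσ : MDifferentiable 𝓘(ℝ, H.Model) 𝓘(ℝ, H.Model × ρ.sub) (ρ.homogSection φ hφ_equiv) :=
    (ρ.contMDiff_homogSection hφ hφ_equiv).mdifferentiable (by simp)
  have hφd : MDifferentiable 𝓘(ℝ, E) 𝓘(ℝ, ρ.sub) φ := hφ.mdifferentiable (by simp)
  have h1 := congrFun (tangentMap_comp hσ H.mdifferentiable_mk)
    ⟨u, mulInvariantVectorField X u⟩
  have e : ρ.homogSection φ hφ_equiv ∘ (QuotientGroup.mk : G → G ⧸ H.toSubgroup) =
      (fun p : G × ρ.sub => ρ.cls p.1 p.2) ∘ fun u => (u, φ u) := rfl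
  have h2 := congrFun (tangentMap_comp ρ.mdifferentiable_cls (mdifferentiable_id.prodMk hφd))
    ⟨u, mulInvariantVectorField X u⟩
  refine h1.symm.trans ((congrArg (fun F => tangentMap 𝓘(ℝ, E) 𝓘(ℝ, H.Model × ρ.sub) F
    ⟨u, mulInvariantVectorField X u⟩) e).trans (h2.trans ?_))
  refine congrArg (tangentMap (𝓘(ℝ, E).prod 𝓘(ℝ, ρ.sub)) 𝓘(ℝ, H.Model × ρ.sub)
    fun p : G × ρ.sub => ρ.cls p.1 p.2) ?_
  refine TangentBundle.mk_eq_mk (E := E × ρ.sub) (I := 𝓘(ℝ, E).prod 𝓘(ℝ, ρ.sub)) rfl ?_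
  rw [mfderiv_prodMk (mdifferentiable_id u) (hφd u), mfderiv_id]
  rfl

end HomogRep

theorem proposition5p6 {E G K : Type*}
    [NormedAddCommGroup E] [NormedSpace ℝ E] [CompleteSpace E]
    [TopologicalSpace G] [ChartedSpace E G] [Group G] [LieGroup 𝓘(ℝ, E) ∞ G]
    [NormedAddCommGroup K] [InnerProductSpace ℂ K] [CompleteSpace K]
    (H : BanachLieSubgroup E G) (ρ : HomogRep H K)
    (m : Submodule ℝ (GroupLieAlgebra 𝓘(ℝ, E) G))
    (hm_closed : IsClosed (m : Set (GroupLieAlgebra 𝓘(ℝ, E) G)))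
    (hm : IsCompl H.lieAlgebra m)
    (φ : G → ρ.sub) (hφ : ContMDiff 𝓘(ℝ, E) 𝓘(ℝ, ρ.sub) ∞ φ)
    (hφ_equiv : ∀ u : G, ∀ w ∈ H.toSubgroup, (φ (u * w) : K) = ρ.act w⁻¹ (φ u)) :
    (∀ (g : G) (X : GroupLieAlgebra 𝓘(ℝ, E) G) (f h : ρ.sub),
      ρ.natConn (ρ.tangentClass g X f h) =
        ρ.tangentClass g 0 f (ρ.P (ρ.deriv X f) + h)) ∧
    ContMDiff 𝓘(ℝ, H.Model) 𝓘(ℝ, H.Model × ρ.sub) ∞ (ρ.homogSection φ hφ_equiv) ∧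
    (∀ v : TangentBundle 𝓘(ℝ, H.Model) (G ⧸ H.toSubgroup),
      ∃ u : G, ∃ X ∈ m, v = H.baseTangent u X) ∧
    ∀ u : G, ∀ X ∈ m,
      ρ.covDeriv ρ.natConn (ρ.homogSection φ hφ_equiv) (H.baseTangent u X) =
        ρ.cls u (ρ.leftDeriv φ u X + ρ.P (ρ.deriv X (φ u))) := by
  refine ⟨ρ.natConn_tangentClass, ρ.contMDiff_homogSection hφ hφ_equiv,
    H.exists_baseTangent_eq hm, fun u X _ => ?_⟩
  rw [HomogRep.covDeriv, ρ.tangentMap_homogSection hφ, ρ.natConn_tangentClass,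
    ρ.vertProj_tangentClass_zero, add_comm]
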